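/- Let $G$ be a finitely generated group and let $(Q_j)_{j\in\mathbb N}$ be a F\o lner sequence in $G$ (finite subsets with $|SQ_j\setminus Q_j|/|Q_j|\to 0$ for every finite $S\subset G$; in particular $G$ is amenable) which is strictly increasing ($|Q_j|<|Q_{j+1}|$ for all $j$), tempered (for some $C>0$, $|\bigcup_{k<n}Q_k^{-1}Q_n|\le C|Q_n|$ for all $n$) and consists of monotiles (for each $j$ there is $T\subset G$ such that $G$ is the disjoint union of the sets $Q_jt$, $t\in T$). Let $p\in\ell^1(G)$ satisfy $0\le p(x)\le 1$ and $p(x)=p(x^{-1})$ for all $x\in G$. Let $\Gamma_\omega$ be the random graph with vertex set $G$ in which, independently for distinct edges, each unordered pair $[x,y]$ with $x\ne y$ is an edge with probability $p(xy^{-1})$; let $\mathbb P$ be the corresponding product measure on $\Omega=\{0,1\}^E$, where $E$ is the set of all such pairs. Almost surely $\Gamma_\omega$ is locally finite, and then $\Delta_\omega$ denotes its Laplace operator in $\ell^2(G)$, that is, the closure (the unique selfadjoint extension) of the operator $f\mapsto\bigl(x\mapsto\sum_{y:[x,y]\in E_\omega}(f(x)-f(y))\bigr)$ on the finitely supported functions,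 $E_\omega$ being the edge set of $\Gamma_\omega$. For finite $Q\subset G$ let $\Delta_\omega[Q]$ be the compression of $\Delta_\omega$ to $\ell^2(Q)$ (restrict to functions supported in $Q$, then project to $\ell^2(Q)$), and let $n(\Delta_\omega[Q])(E)$ be the number of its eigenvalues not exceeding $E$, counted with multiplicity. Then there is a (non-random) function $N:\mathbb R\to\mathbb R$, the integrated density of states (IDS), such that almost surely $n(\Delta_\omega[Q_j])/|Q_j|\to N$ uniformly on $\mathbb R$ as $j\to\infty$, and there is a set $\tilde\Omega\subset\Omega$ of full measure such that for each $\omega\in\tilde\Omega$ the graph $\Gamma_\omega$ is locally finite and for each $\lambda\in\mathbb R$ the following assertions are equivalent: (a) $\lambda$ is a point of discontinuity of $N$; (b) $\Delta_\omega$ has a finitely supported eigenfunction corresponding to $\lambda$; (c) $\Delta_\omega$ has infinitely many linearly independent finitely supported eigenfunctions corresponding to $\lambda$. -/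

import Mathlib

open Filter Topology MeasureTheory ProbabilityTheory
open scoped Pointwise ENNReal

noncomputable section

/-! ### Sequences of finite subsets of a group -/

section Foelner

variable {G : Type*} [Group G]

/-- Følner sequence: `|S Q_j \ Q_j| / |Q_j| → 0` for every finite `S ⊆ G`. -/
def IsFolnerSeq (Q : ℕ → Finset G) : Prop :=
  ∀ S : Finset G, Tendsto
    (fun j => ((((S : Set G) * (Q j : Set G)) \ (Q j : Set G)).ncard : ℝ) / ((Q j).card : ℝ))
    atTop (𝓝 0)

/-- `Q` is a monotile: for some `T ⊆ G`, the group is the disjoint union of the sets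
`Q t`, `t ∈ T`. -/
def IsMonotile (Q : Finset G) : Prop :=
  ∃ T : Set G, (⋃ t ∈ T, (Q : Set G) * {t}) = Set.univ ∧
    T.PairwiseDisjoint (fun t => (Q : Set G) * {t})

/-- Tempered sequence: `|⋃_{k < n} Q_k⁻¹ Q_n| ≤ C |Q_n|` for all `n`. -/
def IsTempered (Q : ℕ → Finset G) : Prop :=
  ∃ C : ℝ, 0 < C ∧ ∀ n,
    ((⋃ k ∈ Set.Iio n, (Q k : Set G)⁻¹ * (Q n : Set G)).ncard : ℝ) ≤ C * ((Q n).card : ℝ)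

end Foelner

/-! ### Long-range percolation -/

/-- The edges of the complete undirected graph on `V`: unordered pairs of distinct vertices. -/
abbrev Edge (V : Type*) : Type _ := {e : Sym2 V // ¬ e.IsDiag}

/-- Percolation configurations, with the `σ`-algebra generated by the cylinder sets (the instance
of the product type). -/
abbrev Config (V : Type*) : Type _ := Edge V → Bool

/-- The functions `p ∈ ℓ¹(G)` with `0 ≤ p ≤ 1` and `p(x) = p(x⁻¹)`. -/
structure EdgeProfile (G : Type*) [Group G] where
  /-- the function -/
  prob : G → ↥unitInterval
  symm : ∀ x, prob x⁻¹ = prob x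
  summable : Summable (fun x => (prob x : ℝ))

/-- The probability `p(x y⁻¹)` that the edge `[x, y]` is open. -/
def EdgeProfile.edgeProb {G : Type*} [Group G] (p : EdgeProfile G) (e : Sym2 G) : ↥unitInterval :=
  Sym2.lift ⟨fun x y => p.prob (x * y⁻¹), fun x y => by
    have h := p.symm (x * y⁻¹)
    rw [mul_inv_rev, inv_inv] at h
    exact h.symm⟩ e

/-- The product measure on configurations: edges are open independently, the edge `[x, y]` with
probability `p(x y⁻¹)`. -/
def EdgeProfile.law {G : Type*} [Group G] (p : EdgeProfile G) : Measure (Config G) :=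
  Measure.infinitePi (fun e : Edge G => bernoulliMeasure true false (p.edgeProb e.1))

/-- The graph of open edges. -/
def percGraph {V : Type*} (ω : Config V) : SimpleGraph V where
  Adj x y := ∃ h : ¬ (s(x, y)).IsDiag, ω ⟨s(x, y), h⟩ = true
  symm := ⟨fun x y => by
    rintro ⟨h, hω⟩
    have e : s(y, x) = s(x, y) := Sym2.eq_swap
    refine ⟨by rw [e]; exact h, ?_⟩
    rw [← hω]
    congr 1
    exact Subtype.ext e⟩
  loopless := ⟨fun x => by rintro ⟨h, -⟩; exact h (by simp)⟩

/-! ### The graph Laplacian on `ℓ²` -/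

section Laplacian

variable {V : Type*}

/-- Every vertex has finitely many neighbours. -/
def IsLocallyFinite (Γ : SimpleGraph V) : Prop := ∀ x, (Γ.neighborSet x).Finite

/-- `f ↦ (x ↦ ∑_{y ∼ x} (f(x) - f(y)))`. -/
def formalLaplacian (Γ : SimpleGraph V) (f : V → ℂ) (x : V) : ℂ :=
  ∑ᶠ y ∈ Γ.neighborSet x, (f x - f y)

/-- The Hilbert space `ℓ²(V)`. -/
abbrev Ell2 (V : Type*) : Type _ := lp (fun _ : V => ℂ) 2

/-- `C_c(V)`, the finitely supported functions, as a subspace of `ℓ²(V)`. -/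
def finSupported (V : Type*) : Submodule ℂ (Ell2 V) where
  carrier := {f | (Function.support (f : V → ℂ)).Finite}
  zero_mem' := by
    simp only [Set.mem_ofPred_eq, lp.coeFn_zero, Function.support_zero, Set.finite_empty]
  add_mem' {f g} hf hg := by
    refine (Set.Finite.union hf hg).subset ?_
    rw [lp.coeFn_add]
    exact Function.support_add _ _
  smul_mem' c f hf := by
    refine Set.Finite.subset hf ?_
    rw [lp.coeFn_smul]
    exact Function.support_const_smul_subset c _

theorem formalLaplacian_add {Γ : SimpleGraph V} (h : IsLocallyFinite Γ) (f g : V → ℂ) :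
    formalLaplacian Γ (f + g) = formalLaplacian Γ f + formalLaplacian Γ g := by
  funext x
  simp only [formalLaplacian, Pi.add_apply]
  rw [← finsum_mem_add_distrib (h x)]
  exact finsum_mem_congr rfl fun y _ => by ring

theorem formalLaplacian_smul {Γ : SimpleGraph V} (c : ℂ) (f : V → ℂ) :
    formalLaplacian Γ (c • f) = c • formalLaplacian Γ f := by
  funext x
  simp only [formalLaplacian, Pi.smul_apply, smul_eq_mul]
  rw [mul_finsum_mem]
  exact finsum_mem_congr rfl fun y _ => by ring

theorem formalLaplacian_memℓp {Γ : SimpleGraph V} (h : IsLocallyFinite Γ) {f : V → ℂ}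
    (hf : (Function.support f).Finite) : Memℓp (formalLaplacian Γ f) 2 := by
  have hfin : (Function.support f ∪ ⋃ y ∈ Function.support f, Γ.neighborSet y).Finite :=
    hf.union (hf.biUnion fun y _ => h y)
  refine (memℓp_zero_iff.2 (hfin.subset ?_)).of_exponent_ge (by simp)
  intro x hx
  by_contra hx'
  simp only [Set.mem_union, Set.mem_iUnion, not_or, not_exists] at hx'
  apply hx
  have hfx : f x = 0 := by simpa using hx'.1
  refine finsum_mem_eq_zero_of_forall_eq_zero fun y hy => ?_
  have hfy : f y = 0 := by
    by_contra hne
    exact hx'.2 y hne (SimpleGraph.Adj.symm hy)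
  rw [hfx, hfy, sub_zero]

/-- The Laplacian on `C_c(V)`, as a densely defined operator in `ℓ²(V)`. -/
def preLaplacian (Γ : SimpleGraph V) (h : IsLocallyFinite Γ) : Ell2 V →ₗ.[ℂ] Ell2 V where
  domain := finSupported V
  toFun :=
    { toFun := fun f => ⟨formalLaplacian Γ (f : Ell2 V), formalLaplacian_memℓp h f.2⟩
      map_add' := fun f g => by
        apply lp.ext
        exact formalLaplacian_add h _ _
      map_smul' := fun c f => by
        apply lp.ext
        exact formalLaplacian_smul c _ }

/-- The Laplace operator: the closure of the Laplacian on `C_c(V)`. That operator is essentially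
selfadjoint, so its closure is its unique selfadjoint extension. -/
def laplacian (Γ : SimpleGraph V) (h : IsLocallyFinite Γ) : Ell2 V →ₗ.[ℂ] Ell2 V :=
  (preLaplacian Γ h).closure

/-- `u` is an eigenfunction of the (unbounded) operator `A` for `μ`. -/
def IsEigenfunction (A : Ell2 V →ₗ.[ℂ] Ell2 V) (μ : ℝ) (u : Ell2 V) : Prop :=
  u ≠ 0 ∧ ∃ hu : u ∈ A.domain, A ⟨u, hu⟩ = (μ : ℂ) • u

open scoped Classical in
/-- The matrix of the restriction `p_Q Δ i_Q` of the Laplacian to `ℓ²(Q)`, for finite `Q`: the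
entry `(x, y)` is the value at `x` of the Laplacian of the indicator function of `y`. -/
def restrictedLaplacian (Γ : SimpleGraph V) (Q : Finset V) : Matrix Q Q ℂ :=
  fun x y => formalLaplacian Γ (Pi.single (y : V) 1) x

open scoped Classical in
theorem formalLaplacian_single (Γ : SimpleGraph V) (x y : V) :
    formalLaplacian Γ (Pi.single y 1) x =
      if x = y then ((Γ.neighborSet x).ncard : ℂ) else if Γ.Adj x y then -1 else 0 := by
  unfold formalLaplacian
  split_ifs with hxy hadj
  · subst hxy
    have h1 : ∀ z ∈ Γ.neighborSet x,
        ((Pi.single x 1 : V → ℂ) x - (Pi.single x 1 : V → ℂ) z) = 1 := by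
      intro z hz
      have hne : z ≠ x := (Γ.ne_of_adj hz).symm
      simp [Pi.single_eq_of_ne hne]
    rw [finsum_mem_congr rfl h1]
    by_cases hf : (Γ.neighborSet x).Finite
    · rw [finsum_mem_eq_finite_toFinset_sum _ hf, Set.ncard_eq_toFinset_card _ hf]
      simp
    · rw [Set.Infinite.ncard hf, finsum_mem_eq_zero_of_infinite]
      · simp
      · have hs : Function.support (fun _ : V => (1 : ℂ)) = Set.univ := by
          ext; simp
        rw [hs, Set.inter_univ]
        exact hf
  · have hset : Γ.neighborSet x ∩ Function.support
        (fun z => (Pi.single y 1 : V → ℂ) x - (Pi.single y 1 : V → ℂ) z) =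
        {y} ∩ Function.support
          (fun z => (Pi.single y 1 : V → ℂ) x - (Pi.single y 1 : V → ℂ) z) := by
      ext z
      simp only [Set.mem_inter_iff, Function.mem_support, Set.mem_singleton_iff,
        Pi.single_eq_of_ne hxy]
      constructor
      · rintro ⟨-, hz⟩
        refine ⟨?_, hz⟩
        by_contra hne
        exact hz (by simp [Pi.single_eq_of_ne hne])
      · rintro ⟨rfl, hz⟩
        exact ⟨hadj, hz⟩
    rw [finsum_mem_inter_support_eq _ _ _ hset, finsum_mem_singleton]
    simp [Pi.single_eq_of_ne hxy]
  · refine finsum_mem_eq_zero_of_forall_eq_zero fun z hz => ?_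
    have hne : z ≠ y := by rintro rfl; exact hadj hz
    simp [Pi.single_eq_of_ne hxy, Pi.single_eq_of_ne hne]

theorem restrictedLaplacian_isHermitian (Γ : SimpleGraph V) (Q : Finset V) :
    (restrictedLaplacian Γ Q).IsHermitian := by
  classical
  ext x y
  simp only [Matrix.conjTranspose_apply, restrictedLaplacian, formalLaplacian_single]
  by_cases hxy : (x : V) = y
  · simp [hxy]
  · simp only [hxy, Ne.symm hxy, if_false, Γ.adj_comm (y : V) x]
    split_ifs <;> simp

open scoped Classical in
/-- The eigenvalue counting function `E ↦ #{i : λ_i ≤ E}` of a Hermitian matrix, the eigenvalues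
`λ_i` being counted with multiplicity. -/
def eigenvalueCount {ι : Type*} [Fintype ι] {A : Matrix ι ι ℂ} (hA : A.IsHermitian) (E : ℝ) : ℕ :=
  (Finset.univ.filter fun i => hA.eigenvalues i ≤ E).card

end Laplacian

/-! ### The integrated density of states -/

/-- `N` is the integrated density of states along `(Q_j)`: almost surely, the normalised
eigenvalue counting functions of the restrictions of the Laplacian to `Q_j` converge to `N` in
supremum norm. -/
def IsIDS {G : Type*} [Group G] (p : EdgeProfile G) (Q : ℕ → Finset G) (N : ℝ → ℝ) : Prop :=
  ∀ᵐ ω ∂p.law, TendstoUniformly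
    (fun (j : ℕ) (E : ℝ) =>
      (eigenvalueCount (restrictedLaplacian_isHermitian (percGraph ω) (Q j)) E : ℝ) /
        ((Q j).card : ℝ))
    N atTop

end

noncomputable section

/-! ### Eigenvalue counting for Hermitian matrices -/

section Hermitian

open scoped Classical

/-! Existence of `N`. Cut a large set into disjoint translates of a tile `B`. The compression to the
large set couples different tiles only through vertices that have a neighbour outside their own
tile. Trial functions vanishing there see a direct sum, and that constraint costs at most one
dimension per vertex (`abs_spectralCount_sub_sum_block_le`). The law is invariant under right
translations, so in the mean all tiles contribute equally. The mean boundary is `o(|Q_j|)`, because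
`p` is summable and each fixed group element moves only `o(|Q_j|)` points out of `Q_j`. Hence the
normalised mean counting functions are uniformly Cauchy (`exists_tendstoUniformly_meanCount`).

From means to almost sure convergence: opening one edge leaves the quadratic form unchanged on a
hyperplane, so it changes a counting function by at most one. Only edges touching `Q` matter, and
their probabilities sum to at most `‖p‖₁ |Q|`. A Chernoff bound for functions of independent bits
gives deviation probabilities exponentially small in `|Q_j| > j`, and Borel–Cantelli applies
(`ae_tendsto_sub_integral_div`). Since `N` may jump, uniformity in the energy comes from controlling
counts of both `≤` and `<` at the rational quantiles of `N` (`tendstoUniformly_of_quantiles`).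

Discontinuities. By uniform convergence, `N` is continuous at `λ` iff the multiplicity of `λ` on
`Q_j` is `o(|Q_j|)`. An eigenvector of the compression that vanishes on the inner boundary extends
by zero to an eigenfunction of the whole Laplacian. As almost surely the boundary is `o(|Q_j|)`, a
jump forces infinitely many independent ones (`exists_linearIndependent_eigenfunctions`).
Conversely, whether a finitely supported `u` is an eigenfunction depends only on the finite pattern
of open edges touching its support. There are countably many patterns, so almost surely only those
of positive probability occur. Such a pattern recurs in the mean in a positive fraction of disjoint
tiles, which makes the mean multiplicity proportional to `|Q_j|`
(`not_continuousAt_of_openPattern`). The exceptional null set involves patterns only, hence serves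
all `λ` at once. -/

/-- Rank–nullity for `L` on `W`: imposing finitely many linear conditions costs at most that many
dimensions. All eigenvalue comparisons below rest on this. -/
theorem finrank_le_finrank_inf_ker_add {E σ : Type*} [AddCommGroup E] [Module ℂ E]
    [FiniteDimensional ℂ E] [Fintype σ] (W : Submodule ℂ E) (L : E →ₗ[ℂ] (σ → ℂ)) :
    Module.finrank ℂ W ≤ Module.finrank ℂ ↥(W ⊓ LinearMap.ker L) + Fintype.card σ := by
  have h1 := LinearMap.finrank_range_add_finrank_ker (L.domRestrict W)
  have h2 : Module.finrank ℂ (LinearMap.range (L.domRestrict W)) ≤ Fintype.card σ := by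
    refine (Submodule.finrank_le _).trans ?_
    simp
  have h3 : Module.finrank ℂ (LinearMap.ker (L.domRestrict W)) =
      Module.finrank ℂ ↥(W ⊓ LinearMap.ker L) := by
    rw [LinearMap.ker_domRestrict]
    rw [← Submodule.map_comap_subtype]
    exact (LinearEquiv.finrank_eq
      (Submodule.equivMapOfInjective W.subtype W.injective_subtype _))
  omega

variable {ι : Type*} [Fintype ι]

/-- The squared Euclidean norm. -/
def normSqSum (v : ι → ℂ) : ℝ := ∑ i, ‖v i‖ ^ 2

/-- The real quadratic form of a matrix. -/
def quadForm (A : Matrix ι ι ℂ) (v : ι → ℂ) : ℝ := (star v ⬝ᵥ A.mulVec v).re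

theorem normSqSum_eq (v : ι → ℂ) : normSqSum v = (star v ⬝ᵥ v).re := by
  simp only [normSqSum, dotProduct, Pi.star_apply, Complex.re_sum, RCLike.star_def]
  refine Finset.sum_congr rfl fun i _ => ?_
  rw [← Complex.normSq_eq_conj_mul_self, Complex.ofReal_re, Complex.normSq_eq_norm_sq]

/-- The number of eigenvalues, with multiplicity, that satisfy `P`. -/
def spectralCount {A : Matrix ι ι ℂ} (hA : A.IsHermitian) (P : ℝ → Prop) : ℕ :=
  (Finset.univ.filter fun i => P (hA.eigenvalues i)).card

theorem eigenvalueCount_eq_spectralCount {A : Matrix ι ι ℂ} (hA : A.IsHermitian) (E : ℝ) :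
    eigenvalueCount hA E = spectralCount hA (· ≤ E) := by
  unfold eigenvalueCount spectralCount
  congr

/-- The coordinates with respect to an eigenvector basis. -/
def spectralCoord {A : Matrix ι ι ℂ} (hA : A.IsHermitian) : (ι → ℂ) →ₗ[ℂ] (ι → ℂ) :=
  Matrix.mulVecLin (star (hA.eigenvectorUnitary : Matrix ι ι ℂ))

variable {A : Matrix ι ι ℂ} (hA : A.IsHermitian)

theorem star_dotProduct_spectralCoord (v w : ι → ℂ) :
    star (spectralCoord hA v) ⬝ᵥ spectralCoord hA w = star v ⬝ᵥ w := by
  simp only [spectralCoord, Matrix.mulVecLin_apply]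
  rw [Matrix.star_mulVec, Matrix.star_eq_conjTranspose, Matrix.conjTranspose_conjTranspose,
    ← Matrix.dotProduct_mulVec, Matrix.mulVec_mulVec, ← Matrix.star_eq_conjTranspose]
  have h : (hA.eigenvectorUnitary : Matrix ι ι ℂ) *
      star (hA.eigenvectorUnitary : Matrix ι ι ℂ) = 1 :=
    Unitary.coe_mul_star_self _
  rw [h, Matrix.one_mulVec]

theorem spectralCoord_mulVec (v : ι → ℂ) (i : ι) :
    spectralCoord hA (A.mulVec v) i = (hA.eigenvalues i : ℂ) * spectralCoord hA v i := by
  have h := hA.spectral_theorem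
  rw [Unitary.conjStarAlgAut_apply] at h
  have h' : (star (hA.eigenvectorUnitary : Matrix ι ι ℂ)) *
      (hA.eigenvectorUnitary : Matrix ι ι ℂ) = 1 :=
    Unitary.coe_star_mul_self _
  have h2 : star (hA.eigenvectorUnitary : Matrix ι ι ℂ) * A =
      Matrix.diagonal (RCLike.ofReal ∘ hA.eigenvalues) *
        star (hA.eigenvectorUnitary : Matrix ι ι ℂ) := by
    refine (congrArg (star (hA.eigenvectorUnitary : Matrix ι ι ℂ) * ·) h).trans ?_
    rw [← mul_assoc, ← mul_assoc, h', one_mul]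
  simp only [spectralCoord, Matrix.mulVecLin_apply]
  rw [Matrix.mulVec_mulVec, h2, ← Matrix.mulVec_mulVec, Matrix.mulVec_diagonal]
  rfl

theorem normSqSum_spectralCoord (v : ι → ℂ) :
    normSqSum v = ∑ i, ‖spectralCoord hA v i‖ ^ 2 := by
  rw [normSqSum_eq, ← star_dotProduct_spectralCoord hA, ← normSqSum_eq, normSqSum]

theorem quadForm_eq_sum (v : ι → ℂ) :
    quadForm A v = ∑ i, hA.eigenvalues i * ‖spectralCoord hA v i‖ ^ 2 := by
  rw [quadForm, ← star_dotProduct_spectralCoord hA]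
  simp only [dotProduct, Pi.star_apply, Complex.re_sum, RCLike.star_def, spectralCoord_mulVec]
  refine Finset.sum_congr rfl fun i _ => ?_
  rw [mul_left_comm, ← Complex.normSq_eq_conj_mul_self, ← Complex.ofReal_mul, Complex.ofReal_re,
    Complex.normSq_eq_norm_sq]

theorem spectralCoord_eq_zero {v : ι → ℂ} (h : spectralCoord hA v = 0) : v = 0 := by
  have h1 := normSqSum_spectralCoord hA v
  rw [h] at h1
  have h2 : ∑ i, ‖v i‖ ^ 2 = 0 := by simpa [normSqSum] using h1
  rw [Finset.sum_eq_zero_iff_of_nonneg (fun i _ => by positivity)] at h2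
  funext i
  simpa using h2 i (Finset.mem_univ i)

/-- One half of the min–max principle: a larger `V` would contain a nonzero vector annihilated by
all coordinates selected by `P`. Keeping `P` arbitrary covers the conditions `≤ E`, `> E` and `= E`
together. -/
theorem finrank_le_spectralCount (P : ℝ → Prop) (V : Submodule ℂ (ι → ℂ))
    (h : ∀ v ∈ V, (∀ i, P (hA.eigenvalues i) → spectralCoord hA v i = 0) → v = 0) :
    Module.finrank ℂ V ≤ spectralCount hA P := by
  let L : (ι → ℂ) →ₗ[ℂ] ({i // P (hA.eigenvalues i)} → ℂ) :=
    (LinearMap.funLeft ℂ ℂ Subtype.val).comp (spectralCoord hA)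
  have h1 := finrank_le_finrank_inf_ker_add V L
  have h2 : V ⊓ LinearMap.ker L = ⊥ := by
    rw [eq_bot_iff]
    rintro v ⟨hv, hL⟩
    refine h v hv fun i hi => ?_
    exact congrFun hL ⟨i, hi⟩
  rw [h2, finrank_bot, zero_add, Fintype.card_subtype] at h1
  exact h1

/-- The other half of min–max: the common kernel of the coordinates not selected by `P`, that is,
the span of the selected eigenvectors. -/
theorem exists_submodule_spectralCount (P : ℝ → Prop) :
    ∃ V : Submodule ℂ (ι → ℂ), spectralCount hA P ≤ Module.finrank ℂ V ∧
      ∀ v ∈ V, ∀ i, ¬ P (hA.eigenvalues i) → spectralCoord hA v i = 0 := by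
  let L : (ι → ℂ) →ₗ[ℂ] ({i // ¬ P (hA.eigenvalues i)} → ℂ) :=
    (LinearMap.funLeft ℂ ℂ Subtype.val).comp (spectralCoord hA)
  have h1 := finrank_le_finrank_inf_ker_add ⊤ L
  refine ⟨⊤ ⊓ LinearMap.ker L, ?_, ?_⟩
  · rw [finrank_top, Module.finrank_fintype_fun_eq_card, Fintype.card_subtype] at h1
    have h3 := Finset.card_filter_add_card_filter_not (s := (Finset.univ : Finset ι))
      (fun i => P (hA.eigenvalues i))
    rw [Finset.card_univ] at h3
    unfold spectralCount
    omega
  · rintro v ⟨-, hL⟩ i hi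
    exact congrFun hL ⟨i, hi⟩

theorem spectralCount_le_card (P : ℝ → Prop) : spectralCount hA P ≤ Fintype.card ι :=
  (Finset.card_filter_le _ _).trans_eq Finset.card_univ

theorem spectralCount_mono {P P' : ℝ → Prop} (h : ∀ x, P x → P' x) :
    spectralCount hA P ≤ spectralCount hA P' :=
  Finset.card_le_card (Finset.monotone_filter_right _ fun _ _ hi => h _ hi)

theorem spectralCount_add_not (P : ℝ → Prop) :
    spectralCount hA P + spectralCount hA (fun x => ¬ P x) = Fintype.card ι := by
  have := Finset.card_filter_add_card_filter_not (s := (Finset.univ : Finset ι))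
      (fun i => P (hA.eigenvalues i))
  rw [Finset.card_univ] at this
  rw [← this]
  unfold spectralCount
  congr!

theorem spectralCount_congr {P P' : ℝ → Prop}
    (h : ∀ i, P (hA.eigenvalues i) ↔ P' (hA.eigenvalues i)) :
    spectralCount hA P = spectralCount hA P' := by
  unfold spectralCount
  congr 1
  exact Finset.filter_congr fun i _ => h i

theorem spectralCount_lt_add_eq (E : ℝ) :
    spectralCount hA (· < E) + spectralCount hA (· = E) = spectralCount hA (· ≤ E) := by
  unfold spectralCount
  rw [← Finset.card_union_of_disjoint]
  · congr 1
    ext i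
    simp [le_iff_lt_or_eq]
  · rw [Finset.disjoint_filter]
    intro i _ h1 h2
    exact h1.ne h2

theorem finrank_le_count_le {E : ℝ} {V : Submodule ℂ (ι → ℂ)}
    (h : ∀ v ∈ V, quadForm A v ≤ E * normSqSum v) :
    Module.finrank ℂ V ≤ spectralCount hA (· ≤ E) := by
  refine finrank_le_spectralCount hA _ V fun v hv h0 => spectralCoord_eq_zero hA ?_
  have h1 := h v hv
  rw [quadForm_eq_sum hA, normSqSum_spectralCoord hA, Finset.mul_sum] at h1
  have h2 : ∀ i ∈ Finset.univ, E * ‖spectralCoord hA v i‖ ^ 2 ≤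
      hA.eigenvalues i * ‖spectralCoord hA v i‖ ^ 2 := by
    intro i _
    rcases le_or_gt (hA.eigenvalues i) E with h3 | h3
    · simp [h0 i h3]
    · gcongr
  -- The hypothesis on the form is not strict, so the contradiction comes from the equality case:
  -- the sums agree, hence all terms do, while a nonzero coordinate with eigenvalue above `E` would
  -- make its term strictly larger.
  have h3 := (Finset.sum_eq_sum_iff_of_le h2).1 (le_antisymm (Finset.sum_le_sum h2) h1)
  funext i
  by_cases h4 : hA.eigenvalues i ≤ E
  · exact h0 i h4
  · have h5 := h3 i (Finset.mem_univ i)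
    by_contra h6
    have h7 : ‖spectralCoord hA v i‖ ^ 2 ≠ 0 := by simpa using h6
    exact h4 (mul_right_cancel₀ h7 h5).ge

theorem exists_submodule_count_le (E : ℝ) :
    ∃ V : Submodule ℂ (ι → ℂ), spectralCount hA (· ≤ E) ≤ Module.finrank ℂ V ∧
      ∀ v ∈ V, quadForm A v ≤ E * normSqSum v := by
  obtain ⟨V, h1, h2⟩ := exists_submodule_spectralCount hA (· ≤ E)
  refine ⟨V, h1, fun v hv => ?_⟩
  rw [quadForm_eq_sum hA, normSqSum_spectralCoord hA, Finset.mul_sum]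
  refine Finset.sum_le_sum fun i _ => ?_
  by_cases h4 : hA.eigenvalues i ≤ E
  · gcongr
  · simp [h2 v hv i h4]

theorem finrank_le_count_gt {E : ℝ} {V : Submodule ℂ (ι → ℂ)}
    (h : ∀ v ∈ V, v ≠ 0 → E * normSqSum v < quadForm A v) :
    Module.finrank ℂ V ≤ spectralCount hA (fun x => ¬ x ≤ E) := by
  refine finrank_le_spectralCount hA _ V fun v hv h0 => ?_
  by_contra hne
  have h1 := h v hv hne
  rw [quadForm_eq_sum hA, normSqSum_spectralCoord hA, Finset.mul_sum] at h1
  refine h1.not_ge (Finset.sum_le_sum fun i _ => ?_)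
  by_cases h4 : hA.eigenvalues i ≤ E
  · gcongr
  · simp [h0 i h4]

theorem exists_submodule_count_gt (E : ℝ) :
    ∃ V : Submodule ℂ (ι → ℂ), spectralCount hA (fun x => ¬ x ≤ E) ≤ Module.finrank ℂ V ∧
      ∀ v ∈ V, v ≠ 0 → E * normSqSum v < quadForm A v := by
  obtain ⟨V, h1, h2⟩ := exists_submodule_spectralCount hA (fun x => ¬ x ≤ E)
  refine ⟨V, h1, fun v hv hne => ?_⟩
  rw [quadForm_eq_sum hA, normSqSum_spectralCoord hA, Finset.mul_sum]
  have h3 : ∃ i, spectralCoord hA v i ≠ 0 := by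
    by_contra! h3
    exact hne (spectralCoord_eq_zero hA (funext h3))
  obtain ⟨i, hi⟩ := h3
  have hlt : ∀ j, spectralCoord hA v j ≠ 0 → E < hA.eigenvalues j := by
    intro j hj
    by_contra h4
    exact hj (h2 v hv j (by simpa using h4))
  refine Finset.sum_lt_sum (fun j _ => ?_) ⟨i, Finset.mem_univ i, ?_⟩
  · by_cases h4 : spectralCoord hA v j = 0
    · simp [h4]
    · have := (hlt j h4).le
      gcongr
  · have := hlt i hi
    have h5 : 0 < ‖spectralCoord hA v i‖ ^ 2 := by positivity
    gcongr

theorem finrank_le_count_eq {E : ℝ} {V : Submodule ℂ (ι → ℂ)}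
    (h : ∀ v ∈ V, A.mulVec v = (E : ℂ) • v) :
    Module.finrank ℂ V ≤ spectralCount hA (· = E) := by
  refine finrank_le_spectralCount hA _ V fun v hv h0 => spectralCoord_eq_zero hA ?_
  funext i
  by_cases h4 : hA.eigenvalues i = E
  · exact h0 i h4
  · have h5 := spectralCoord_mulVec hA v i
    rw [h v hv, map_smul, Pi.smul_apply, smul_eq_mul] at h5
    by_contra h6
    have h7 := mul_right_cancel₀ h6 h5
    exact h4 (by exact_mod_cast h7.symm)

theorem exists_submodule_count_eq (E : ℝ) :
    ∃ V : Submodule ℂ (ι → ℂ), spectralCount hA (· = E) ≤ Module.finrank ℂ V ∧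
      ∀ v ∈ V, A.mulVec v = (E : ℂ) • v := by
  obtain ⟨V, h1, h2⟩ := exists_submodule_spectralCount hA (· = E)
  refine ⟨V, h1, fun v hv => ?_⟩
  rw [← sub_eq_zero]
  refine spectralCoord_eq_zero hA ?_
  funext i
  rw [map_sub, map_smul, Pi.sub_apply, spectralCoord_mulVec, Pi.smul_apply, smul_eq_mul]
  by_cases h4 : hA.eigenvalues i = E
  · rw [h4]; simp
  · simp [h2 v hv i h4]

end Hermitian

/-! ### Stability of eigenvalue counts: hyperplane perturbations and block decompositions -/

section HermitianComparison

open scoped Classical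

variable {ι : Type*} [Fintype ι]

/-- A subspace on which the first form is at most `E` loses at most one dimension on the hyperplane
`l = 0`, where the two forms agree. -/
theorem spectralCount_le_add_one_of_quadForm_eq {A A' : Matrix ι ι ℂ} (hA : A.IsHermitian)
    (hA' : A'.IsHermitian) (l : (ι → ℂ) →ₗ[ℂ] ℂ)
    (h : ∀ v, l v = 0 → quadForm A v = quadForm A' v) (E : ℝ) :
    spectralCount hA (· ≤ E) ≤ spectralCount hA' (· ≤ E) + 1 := by
  obtain ⟨V, h1, h2⟩ := exists_submodule_count_le hA E
  let L : (ι → ℂ) →ₗ[ℂ] (Unit → ℂ) := LinearMap.pi fun _ => l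
  have h3 := finrank_le_finrank_inf_ker_add V L
  have h4 : Module.finrank ℂ ↥(V ⊓ LinearMap.ker L) ≤ spectralCount hA' (· ≤ E) := by
    refine finrank_le_count_le hA' ?_
    rintro v ⟨hv, hl⟩
    rw [← h v (congrFun hl ())]
    exact h2 v hv
  rw [Fintype.card_unit] at h3
  omega

/-- There are finitely many eigenvalues, so none lies in some interval just left of `E`. -/
theorem exists_lt_spectralCount_lt_eq {A : Matrix ι ι ℂ} (hA : A.IsHermitian) (E : ℝ) :
    ∃ E₀ < E, ∀ E', E₀ ≤ E' → E' < E →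
      spectralCount hA (· ≤ E') = spectralCount hA (· < E) := by
  have h : ∀ᶠ E' in 𝓝[<] E, ∀ i, hA.eigenvalues i < E → hA.eigenvalues i < E' := by
    rw [Filter.eventually_all]
    intro i
    rw [Filter.eventually_imp_distrib_left]
    intro hi
    exact nhdsWithin_le_nhds (lt_mem_nhds hi)
  obtain ⟨E₀, h0, h1⟩ := (mem_nhdsLT_iff_exists_Ioo_subset).1 h
  obtain ⟨E₁, h2, h3⟩ := exists_between (Set.mem_Iio.1 h0)
  refine ⟨E₁, h3, fun E' h4 h5 => spectralCount_congr hA fun i => ?_⟩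
  exact ⟨fun h6 => h6.trans_lt h5, fun h6 => (h1 ⟨h2.trans_le h4, h5⟩ i h6).le⟩

theorem exists_gt_spectralCount_le_eq {A : Matrix ι ι ℂ} (hA : A.IsHermitian) (E : ℝ) :
    ∃ E₀ > E, ∀ E', E ≤ E' → E' < E₀ →
      spectralCount hA (· ≤ E') = spectralCount hA (· ≤ E) := by
  have h : ∀ᶠ E' in 𝓝[>] E, ∀ i, E < hA.eigenvalues i → E' < hA.eigenvalues i := by
    rw [Filter.eventually_all]
    intro i
    rw [Filter.eventually_imp_distrib_left]
    intro hi
    exact nhdsWithin_le_nhds (gt_mem_nhds hi)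
  obtain ⟨E₀, h0, h1⟩ := (mem_nhdsGT_iff_exists_Ioo_subset).1 h
  refine ⟨E₀, h0, fun E' h4 h5 => spectralCount_congr hA fun i =>
    ⟨fun h6 => ?_, fun h6 => h6.trans h4⟩⟩
  by_contra h7
  rcases h4.eq_or_lt with rfl | h8
  · exact h7 h6
  · exact (h1 ⟨h8, h5⟩ i (not_le.1 h7)).not_ge h6

theorem eventually_spectralCount_natCast {A : Matrix ι ι ℂ} (hA : A.IsHermitian) :
    ∀ᶠ n : ℕ in atTop,
      spectralCount hA (· ≤ (n : ℝ)) = spectralCount hA (fun _ => True) := by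
  have h : ∀ᶠ n : ℕ in atTop, ∀ i, hA.eigenvalues i ≤ n :=
    Filter.eventually_all.2 fun i => tendsto_natCast_atTop_atTop.eventually_ge_atTop _
  filter_upwards [h] with n hn
  exact spectralCount_congr hA fun i => iff_true_intro (hn i)

theorem eventually_spectralCount_neg_natCast {A : Matrix ι ι ℂ} (hA : A.IsHermitian) :
    ∀ᶠ n : ℕ in atTop,
      spectralCount hA (· ≤ -(n : ℝ)) = spectralCount hA (fun _ => False) := by
  have h : ∀ᶠ n : ℕ in atTop, ∀ i, -hA.eigenvalues i < n :=
    Filter.eventually_all.2 fun i => tendsto_natCast_atTop_atTop.eventually_gt_atTop _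
  filter_upwards [h] with n hn
  exact spectralCount_congr hA fun i => iff_false_intro (not_le.2 (neg_lt.1 (hn i)))

theorem spectralCount_lt_le_add_one_of_quadForm_eq {A A' : Matrix ι ι ℂ} (hA : A.IsHermitian)
    (hA' : A'.IsHermitian) (l : (ι → ℂ) →ₗ[ℂ] ℂ)
    (h : ∀ v, l v = 0 → quadForm A v = quadForm A' v) (E : ℝ) :
    spectralCount hA (· < E) ≤ spectralCount hA' (· < E) + 1 := by
  obtain ⟨E₀, h0, h1⟩ := exists_lt_spectralCount_lt_eq hA E
  obtain ⟨E₁, h2, h3⟩ := exists_lt_spectralCount_lt_eq hA' E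
  have hm : max E₀ E₁ < E := max_lt h0 h2
  rw [← h1 _ (le_max_left _ _) hm, ← h3 _ (le_max_right _ _) hm]
  exact spectralCount_le_add_one_of_quadForm_eq hA hA' l h _

/-- The enumeration `eigenvalues` depends on choices; the roots of the characteristic polynomial do
not, which makes the count invariant under reindexing. -/
theorem spectralCount_eq_card_roots {A : Matrix ι ι ℂ} (hA : A.IsHermitian) (P : ℝ → Prop) :
    spectralCount hA P = (A.charpoly.roots.filter fun z => P z.re).card := by
  rw [hA.roots_charpoly_eq_eigenvalues, Multiset.filter_map, Multiset.card_map]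
  rfl

theorem spectralCount_reindex {κ : Type*} [Fintype κ] {A : Matrix ι ι ℂ} {B : Matrix κ κ ℂ}
    (hA : A.IsHermitian) (hB : B.IsHermitian) (e : κ ≃ ι) (h : ∀ x y, B x y = A (e x) (e y))
    (P : ℝ → Prop) : spectralCount hB P = spectralCount hA P := by
  have h1 : B = Matrix.reindex e.symm e.symm A := by
    ext x y
    simp [h]
  have h2 : B.charpoly = A.charpoly := by rw [h1, Matrix.charpoly_reindex]
  rw [spectralCount_eq_card_roots hB, spectralCount_eq_card_roots hA, h2]

theorem sum_mul_extend_zero {κ : Type*} [Fintype κ] {φ : κ → ι} (hφ : Function.Injective φ)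
    (f : ι → ℂ → ℂ) (hf : ∀ i, f i 0 = 0) (u : κ → ℂ) :
    ∑ i, f i (Function.extend φ u 0 i) = ∑ s, f (φ s) (u s) := by
  symm
  refine Finset.sum_of_injOn φ hφ.injOn (by simp) ?_ ?_
  · intro i _ hi
    rw [Function.extend_apply' _ _ _ (by simpa using hi)]
    exact hf i
  · intro s _
    rw [hφ.extend_apply]

theorem quadForm_extend_zero {κ : Type*} [Fintype κ] {φ : κ → ι} (hφ : Function.Injective φ)
    (A : Matrix ι ι ℂ) (u : κ → ℂ) :
    quadForm A (Function.extend φ u 0) = quadForm (A.submatrix φ φ) u := by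
  unfold quadForm
  simp only [dotProduct, Matrix.mulVec, Pi.star_apply, Matrix.submatrix_apply]
  congr 1
  rw [sum_mul_extend_zero hφ (fun i z => star z * ∑ j, A i j * Function.extend φ u 0 j) (by simp)]
  refine Finset.sum_congr rfl fun s _ => ?_
  rw [sum_mul_extend_zero hφ (fun j z => A (φ s) j * z) (by simp)]

theorem normSqSum_extend_zero {κ : Type*} [Fintype κ] {φ : κ → ι} (hφ : Function.Injective φ)
    (u : κ → ℂ) : normSqSum (Function.extend φ u 0) = normSqSum u := by
  rw [normSqSum_eq, normSqSum_eq]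
  simp only [dotProduct, Pi.star_apply]
  rw [sum_mul_extend_zero hφ (fun i z => star z * z) (by simp)]

variable {κ : Type*} [Fintype κ] {m : κ → Type*} [∀ i, Fintype (m i)]

/-- In a row outside `D` the entries leading to other blocks vanish; a row in `D` is multiplied by a
coordinate of `w` that vanishes. So it suffices to control rows. -/
theorem quadForm_sigma (A : Matrix (Σ i, m i) (Σ i, m i) ℂ) (D : ∀ i, Finset (m i))
    (hD : ∀ i j x y, i ≠ j → x ∉ D i → A ⟨i, x⟩ ⟨j, y⟩ = 0) (w : ∀ i, m i → ℂ)
    (hw : ∀ i, ∀ x ∈ D i, w i x = 0) :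
    quadForm A (fun s => w s.1 s.2) =
      ∑ i, quadForm (A.submatrix (Sigma.mk i) (Sigma.mk i)) (w i) := by
  unfold quadForm
  simp only [dotProduct, Matrix.mulVec, Pi.star_apply, Matrix.submatrix_apply, Complex.re_sum]
  rw [Fintype.sum_sigma]
  refine Finset.sum_congr rfl fun i _ => Finset.sum_congr rfl fun x _ => ?_
  by_cases hx : x ∈ D i
  · simp [hw i x hx]
  · congr 2
    rw [Fintype.sum_sigma]
    rw [Finset.sum_eq_single i]
    · intro j _ hj
      refine Finset.sum_eq_zero fun y _ => ?_
      rw [hD i j x y hj.symm hx, zero_mul]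
    · simp

theorem normSqSum_sigma (w : ∀ i, m i → ℂ) :
    normSqSum (fun s : Σ i, m i => w s.1 s.2) = ∑ i, normSqSum (w i) := by
  unfold normSqSum
  rw [Fintype.sum_sigma]

/-- Subspaces of the blocks, cut down to vectors that vanish on the block boundaries, embed as a
direct sum on which the quadratic form is the sum of those of the blocks. -/
theorem exists_submodule_of_blocks {A : Matrix ι ι ℂ}
    {φ : (Σ i, m i) → ι} (hφ : Function.Injective φ) (D : ∀ i, Finset (m i))
    (hD : ∀ i j x y, i ≠ j → x ∉ D i → A (φ ⟨i, x⟩) (φ ⟨j, y⟩) = 0)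
    (V : ∀ i, Submodule ℂ (m i → ℂ)) :
    ∃ W : Submodule ℂ (ι → ℂ),
      ∑ i, Module.finrank ℂ (V i) ≤ Module.finrank ℂ W + ∑ i, (D i).card ∧
      ∀ v ∈ W, ∃ w : ∀ i, m i → ℂ, (∀ i, w i ∈ V i) ∧
        quadForm A v = ∑ i, quadForm (A.submatrix (fun x => φ ⟨i, x⟩) (fun x => φ ⟨i, x⟩)) (w i) ∧
        normSqSum v = ∑ i, normSqSum (w i) ∧ (v ≠ 0 → ∃ i, w i ≠ 0) := by
  let L : ∀ i, (m i → ℂ) →ₗ[ℂ] (D i → ℂ) := fun i => LinearMap.funLeft ℂ ℂ Subtype.val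
  let V' : ∀ i, Submodule ℂ (m i → ℂ) := fun i => V i ⊓ LinearMap.ker (L i)
  let Ψ : (∀ i, V' i) →ₗ[ℂ] ((Σ i, m i) → ℂ) :=
    LinearMap.pi fun s => (LinearMap.proj s.2).comp ((V' s.1).subtype.comp (LinearMap.proj s.1))
  let Φ : (∀ i, V' i) →ₗ[ℂ] (ι → ℂ) := (Function.ExtendByZero.linearMap ℂ φ).comp Ψ
  have hΦ : ∀ w, Φ w = Function.extend φ (fun s => (w s.1 : m s.1 → ℂ) s.2) 0 := fun w => rfl
  have hinj : Function.Injective Φ := by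
    intro w w' h
    rw [hΦ, hΦ] at h
    funext i
    apply Subtype.ext
    funext x
    have := congrFun h (φ ⟨i, x⟩)
    rwa [hφ.extend_apply, hφ.extend_apply] at this
  refine ⟨LinearMap.range Φ, ?_, ?_⟩
  · rw [LinearMap.finrank_range_of_inj hinj, Module.finrank_pi_fintype, ← Finset.sum_add_distrib]
    refine Finset.sum_le_sum fun i _ => ?_
    have := finrank_le_finrank_inf_ker_add (V i) (L i)
    rwa [Fintype.card_coe] at this
  · rintro _ ⟨w, rfl⟩
    refine ⟨fun i => w i, fun i => (w i).2.1, ?_, ?_, ?_⟩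
    · rw [hΦ, quadForm_extend_zero hφ]
      rw [quadForm_sigma (A.submatrix φ φ) D hD (fun i => w i)
        (fun i x hx => congrFun (w i).2.2 ⟨x, hx⟩)]
      rfl
    · rw [hΦ, normSqSum_extend_zero hφ, normSqSum_sigma (fun i => (w i : m i → ℂ))]
    · intro hne
      by_contra! h
      apply hne
      have : w = 0 := by
        funext i
        exact Subtype.ext (h i)
      rw [this, map_zero]

theorem sum_count_le_block {A : Matrix ι ι ℂ} (hA : A.IsHermitian)
    {φ : (Σ i, m i) → ι} (hφ : Function.Injective φ) (D : ∀ i, Finset (m i))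
    (hD : ∀ i j x y, i ≠ j → x ∉ D i → A (φ ⟨i, x⟩) (φ ⟨j, y⟩) = 0)
    (hB : ∀ i, (A.submatrix (fun x => φ ⟨i, x⟩) (fun x => φ ⟨i, x⟩)).IsHermitian) (E : ℝ) :
    ∑ i, spectralCount (hB i) (· ≤ E) ≤ spectralCount hA (· ≤ E) + ∑ i, (D i).card := by
  choose V h1 h2 using fun i => exists_submodule_count_le (hB i) E
  obtain ⟨W, h3, h4⟩ := exists_submodule_of_blocks hφ D hD V
  refine (Finset.sum_le_sum fun i _ => h1 i).trans (h3.trans ?_)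
  gcongr
  refine finrank_le_count_le hA fun v hv => ?_
  obtain ⟨w, hw, h5, h6, -⟩ := h4 v hv
  rw [h5, h6, Finset.mul_sum]
  exact Finset.sum_le_sum fun i _ => h2 i _ (hw i)

/-- Counting eigenvalues above `E` is what gives an upper bound for the number below: the two counts
add up to the dimension, for the whole matrix and for each block. -/
theorem sum_count_gt_block {A : Matrix ι ι ℂ} (hA : A.IsHermitian)
    {φ : (Σ i, m i) → ι} (hφ : Function.Injective φ) (D : ∀ i, Finset (m i))
    (hD : ∀ i j x y, i ≠ j → x ∉ D i → A (φ ⟨i, x⟩) (φ ⟨j, y⟩) = 0)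
    (hB : ∀ i, (A.submatrix (fun x => φ ⟨i, x⟩) (fun x => φ ⟨i, x⟩)).IsHermitian) (E : ℝ) :
    ∑ i, spectralCount (hB i) (fun x => ¬ x ≤ E) ≤
      spectralCount hA (fun x => ¬ x ≤ E) + ∑ i, (D i).card := by
  choose V h1 h2 using fun i => exists_submodule_count_gt (hB i) E
  obtain ⟨W, h3, h4⟩ := exists_submodule_of_blocks hφ D hD V
  refine (Finset.sum_le_sum fun i _ => h1 i).trans (h3.trans ?_)
  gcongr
  refine finrank_le_count_gt hA fun v hv hne => ?_
  obtain ⟨w, hw, h5, h6, h7⟩ := h4 v hv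
  obtain ⟨i, hi⟩ := h7 hne
  rw [h5, h6, Finset.mul_sum]
  refine Finset.sum_lt_sum (fun j _ => ?_) ⟨i, Finset.mem_univ i, h2 i _ (hw i) hi⟩
  -- Strictness is available only for nonzero components; zero components contribute equality, and
  -- `hi` supplies one strict term.
  by_cases hj : w j = 0
  · simp [hj, quadForm, normSqSum]
  · exact (h2 j _ (hw j) hj).le

/-- The counting function of a matrix differs from the sum of those of disjoint diagonal blocks
by at most the total size of the block boundaries plus the number of uncovered indices. -/
theorem abs_spectralCount_sub_sum_block_le {A : Matrix ι ι ℂ} (hA : A.IsHermitian)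
    {φ : (Σ i, m i) → ι} (hφ : Function.Injective φ) (D : ∀ i, Finset (m i))
    (hD : ∀ i j x y, i ≠ j → x ∉ D i → A (φ ⟨i, x⟩) (φ ⟨j, y⟩) = 0)
    (hB : ∀ i, (A.submatrix (fun x => φ ⟨i, x⟩) (fun x => φ ⟨i, x⟩)).IsHermitian) (E : ℝ) :
    |(spectralCount hA (· ≤ E) : ℝ) - ∑ i, (spectralCount (hB i) (· ≤ E) : ℝ)| ≤
      ∑ i, ((D i).card : ℝ) + ((Fintype.card ι : ℝ) - ∑ i, (Fintype.card (m i) : ℝ)) := by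
  have h1 := sum_count_le_block hA hφ D hD hB E
  have h2 := sum_count_gt_block hA hφ D hD hB E
  have h3 : ∑ i, (spectralCount (hB i) (· ≤ E) + spectralCount (hB i) (fun x => ¬ x ≤ E)) =
      ∑ i, Fintype.card (m i) := Finset.sum_congr rfl fun i _ => spectralCount_add_not (hB i) _
  have h4 := spectralCount_add_not hA (· ≤ E)
  have h5 : ∑ i, Fintype.card (m i) ≤ Fintype.card ι := by
    rw [← Fintype.card_sigma]
    exact Fintype.card_le_of_injective φ hφ
  rw [Finset.sum_add_distrib] at h3
  rw [abs_le]
  constructor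
  · have : (∑ i, spectralCount (hB i) (· ≤ E) : ℝ) ≤
        spectralCount hA (· ≤ E) + ∑ i, ((D i).card : ℝ) := by exact_mod_cast h1
    have : (∑ i, (Fintype.card (m i) : ℝ)) ≤ Fintype.card ι := by exact_mod_cast h5
    linarith
  · have h6 : (∑ i, spectralCount (hB i) (fun x => ¬ x ≤ E) : ℝ) ≤
        spectralCount hA (fun x => ¬ x ≤ E) + ∑ i, ((D i).card : ℝ) := by exact_mod_cast h2
    have h7 : (∑ i, spectralCount (hB i) (· ≤ E) : ℝ) +
      ∑ i, (spectralCount (hB i) (fun x => ¬ x ≤ E) : ℝ) = ∑ i, (Fintype.card (m i) : ℝ) := by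
      exact_mod_cast h3
    have h8 : (spectralCount hA (· ≤ E) : ℝ) + spectralCount hA (fun x => ¬ x ≤ E) =
      Fintype.card ι := by exact_mod_cast h4
    linarith

end HermitianComparison

/-! ### Concentration for functions of independent Bernoulli variables -/

section Bernoulli

open scoped Classical

variable {ι : Type*}

/-- The product of the Bernoulli measures with parameters `q`. -/
def bernoulliProduct (q : ι → ↥unitInterval) : Measure (ι → Bool) :=
  Measure.infinitePi (fun e => bernoulliMeasure true false (q e))

instance (q : ι → ↥unitInterval) : IsProbabilityMeasure (bernoulliProduct q) := by
  unfold bernoulliProduct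
  infer_instance

/-- The configuration that agrees with `ω` on `S` and is closed elsewhere. -/
def truncate (S : Finset ι) (ω : ι → Bool) : ι → Bool := fun e => if e ∈ S then ω e else false

theorem truncate_finite (S : Finset ι) (ω : ι → Bool) : {e | truncate S ω e = true}.Finite := by
  refine S.finite_toSet.subset fun e he => ?_
  by_contra h
  have h' : e ∉ S := h
  simp [truncate, h'] at he

theorem truncate_insert_of_true {S : Finset ι} {e : ι} {ω : ι → Bool} (h : ω e = true) :
    truncate (insert e S) ω = Function.update (truncate S ω) e true := by
  funext i
  by_cases hi : i = e
  · subst hi; simp [truncate, h]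
  · simp [truncate, hi]

theorem truncate_insert_of_false {S : Finset ι} {e : ι} {ω : ι → Bool} (h : ω e = false) :
    truncate (insert e S) ω = truncate S ω := by
  funext i
  by_cases hi : i = e
  · subst hi; simp [truncate, h]
  · simp [truncate, hi]

/-- After truncation only finitely many bits matter, so measurability and integrability hold with no
assumption on `f`. -/
theorem exists_comp_restrict_eq_comp_truncate (S : Finset ι) (f : (ι → Bool) → ℝ) :
    ∃ g : (S → Bool) → ℝ, ∀ ω, f (truncate S ω) = g (fun i => ω i) := by
  refine ⟨fun a => f fun e => if h : e ∈ S then a ⟨e, h⟩ else false, fun ω => ?_⟩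
  congr 1

theorem measurable_comp_truncate (S : Finset ι) (f : (ι → Bool) → ℝ) :
    Measurable fun ω => f (truncate S ω) := by
  obtain ⟨g, hg⟩ := exists_comp_restrict_eq_comp_truncate S f
  simp only [hg]
  exact (measurable_of_finite g).comp (by fun_prop)

theorem finite_range_comp_truncate (S : Finset ι) (f : (ι → Bool) → ℝ) :
    (Set.range fun ω => f (truncate S ω)).Finite := by
  obtain ⟨g, hg⟩ := exists_comp_restrict_eq_comp_truncate S f
  simp only [hg]
  refine (Set.finite_range g).subset ?_
  rintro _ ⟨ω, rfl⟩
  exact ⟨_, rfl⟩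

variable (q : ι → ↥unitInterval)

theorem integrable_comp_truncate (S : Finset ι) (f : (ι → Bool) → ℝ) :
    Integrable (fun ω => f (truncate S ω)) (bernoulliProduct q) := by
  obtain ⟨C, hC⟩ := ((finite_range_comp_truncate S f).image (fun x => ‖x‖)).bddAbove
  refine Integrable.of_bound (measurable_comp_truncate S f).aestronglyMeasurable C
    (Filter.Eventually.of_forall fun ω => ?_)
  exact hC ⟨_, ⟨ω, rfl⟩, rfl⟩

theorem bernoulliProduct_eval (e : ι) :
    bernoulliProduct q {ω | ω e = true} = ENNReal.ofReal (q e) := by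
  have h := Measure.infinitePi_map_eval (fun e => bernoulliMeasure true false (q e)) e
  have h2 : bernoulliProduct q {ω | ω e = true} =
      (bernoulliProduct q).map (fun ω => ω e) {true} := by
    rw [Measure.map_apply (by fun_prop) (by simp)]
    rfl
  rw [h2, bernoulliProduct, h,
    bernoulliMeasure_apply_of_mem_of_notMem _ (by simp) (by simp) (by simp)]
  rw [ENNReal.ofReal, ENNReal.coe_inj]
  ext
  simp [unitInterval.coe_toNNReal, (q e).2.1]

theorem integral_eval (e : ι) :
    ∫ ω, (if ω e = true then (1 : ℝ) else 0) ∂(bernoulliProduct q) = q e := by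
  have hm : MeasurableSet {ω : ι → Bool | ω e = true} :=
    measurableSet_eq_fun (measurable_pi_apply e) measurable_const
  have h : (fun ω : ι → Bool => if ω e = true then (1 : ℝ) else 0) =
      Set.indicator {ω | ω e = true} 1 := by
    ext ω
    simp [Set.indicator_apply]
  rw [h, integral_indicator_one hm, measureReal_def, bernoulliProduct_eval,
    ENNReal.toReal_ofReal (q e).2.1]

/-- Conditioning on the bit `e`, which is independent of the bits in `S`. -/
theorem integral_truncate_insert {S : Finset ι} {e : ι} (he : e ∉ S) (f : (ι → Bool) → ℝ) :
    ∫ ω, f (truncate (insert e S) ω) ∂(bernoulliProduct q) =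
      q e * ∫ ω, f (Function.update (truncate S ω) e true) ∂(bernoulliProduct q) +
        (1 - q e) * ∫ ω, f (truncate S ω) ∂(bernoulliProduct q) := by
  have hind : iIndepFun (fun (i : ι) (ω : ι → Bool) => ω i) (bernoulliProduct q) :=
    iIndepFun_infinitePi (X := fun _ b => b) (fun _ => measurable_id)
  have h1 := hind.indepFun_finset {e} S (by simpa using he) (fun i => measurable_pi_apply i)
  have key : ∀ (c : Bool → ℝ) (g : (ι → Bool) → ℝ),
      ∫ ω, c (ω e) * g (truncate S ω) ∂(bernoulliProduct q) =
        (∫ ω, c (ω e) ∂(bernoulliProduct q)) * ∫ ω, g (truncate S ω) ∂(bernoulliProduct q) := by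
    intro c g
    obtain ⟨g', hg'⟩ := exists_comp_restrict_eq_comp_truncate S g
    have h2 : IndepFun (fun ω : ι → Bool => c (ω e)) (fun ω => g (truncate S ω))
        (bernoulliProduct q) := by
      simp only [hg']
      exact h1.comp (φ := fun a => c (a ⟨e, by simp⟩)) (measurable_of_finite _)
        (measurable_of_finite g')
    exact h2.integral_fun_mul_eq_mul_integral
      ((measurable_of_finite c).comp (measurable_pi_apply e)).aestronglyMeasurable
      (measurable_comp_truncate S g).aestronglyMeasurable
  let c₁ : Bool → ℝ := fun b => if b = true then 1 else 0
  let c₀ : Bool → ℝ := fun b => 1 - if b = true then 1 else 0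
  let g : (ι → Bool) → ℝ := fun ω' => f (Function.update ω' e true)
  have hfun : (fun ω => f (truncate (insert e S) ω)) = fun ω =>
      c₁ (ω e) * g (truncate S ω) + c₀ (ω e) * f (truncate S ω) := by
    funext ω
    by_cases h : ω e = true
    · simp [truncate_insert_of_true h, h, c₁, c₀, g]
    · have h' : ω e = false := by simpa using h
      simp [truncate_insert_of_false h', h', c₁, c₀]
  have hint : ∀ (c : Bool → ℝ) (g : (ι → Bool) → ℝ),
      Integrable (fun ω => c (ω e) * g (truncate S ω)) (bernoulliProduct q) := by
    intro c g
    refine (integrable_comp_truncate q S g).bdd_mul (c := max |c true| |c false|)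
      ((measurable_of_finite c).comp (measurable_pi_apply e)).aestronglyMeasurable
      (Filter.Eventually.of_forall fun ω => ?_)
    cases ω e <;> simp
  have hc₁ : Integrable (fun ω : ι → Bool => c₁ (ω e)) (bernoulliProduct q) := by
    refine Integrable.of_bound (C := 1)
      ((measurable_of_finite c₁).comp (measurable_pi_apply e)).aestronglyMeasurable
      (Filter.Eventually.of_forall fun ω => ?_)
    simp only [c₁]
    split_ifs <;> simp
  have h₁ : ∫ ω, c₁ (ω e) ∂(bernoulliProduct q) = q e := integral_eval q e
  have h₀ : ∫ ω, c₀ (ω e) ∂(bernoulliProduct q) = 1 - q e := by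
    have : ∫ ω, c₀ (ω e) ∂(bernoulliProduct q) =
        ∫ ω, (1 - c₁ (ω e)) ∂(bernoulliProduct q) := rfl
    rw [this, integral_sub (integrable_const _) hc₁, h₁]
    simp
  rw [hfun, integral_add (hint c₁ g) (hint c₀ f), key c₁ g, key c₀ f, h₁, h₀]

/-- Centre at the mean and use `exp x ≤ 1 + x + x²` for `|x| ≤ 1`; the linear terms cancel and the
variance `p (1 - p) (a - b)²` remains. The bound has to be proportional to `p`, unlike Hoeffding's,
because infinitely many edges touch a finite set and only the sum of their probabilities is finite.
-/
theorem two_point_exp_le {p s a b d : ℝ} (hp0 : 0 ≤ p) (hp1 : p ≤ 1) (hs : |s| ≤ 1)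
    (hd0 : 0 ≤ d) (hd1 : d ≤ 1) (hab : |a - b| ≤ d) :
    p * Real.exp (s * a) + (1 - p) * Real.exp (s * b) ≤
      Real.exp (s * (p * a + (1 - p) * b) + s ^ 2 * (d * p)) := by
  have hexp : ∀ x : ℝ, |x| ≤ 1 → Real.exp x ≤ 1 + x + x ^ 2 := by
    intro x hx
    have := (abs_le.1 (Real.abs_exp_sub_one_sub_id_le hx)).2
    linarith
  set m := p * a + (1 - p) * b with hm
  have hab1 : |a - b| ≤ 1 := hab.trans hd1
  have h1 : |s * ((1 - p) * (a - b))| ≤ 1 := by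
    rw [abs_mul, abs_mul, abs_of_nonneg (by linarith : 0 ≤ 1 - p)]
    exact mul_le_one₀ hs (by positivity [abs_nonneg (a - b), sub_nonneg.2 hp1])
      (mul_le_one₀ (by linarith) (abs_nonneg _) hab1)
  have h2 : |s * (-p * (a - b))| ≤ 1 := by
    rw [abs_mul, abs_mul, abs_neg, abs_of_nonneg hp0]
    exact mul_le_one₀ hs (by positivity) (mul_le_one₀ hp1 (abs_nonneg _) hab1)
  have e1 : Real.exp (s * a) = Real.exp (s * m) * Real.exp (s * ((1 - p) * (a - b))) := by
    rw [← Real.exp_add]; congr 1; rw [hm]; ring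
  have e2 : Real.exp (s * b) = Real.exp (s * m) * Real.exp (s * (-p * (a - b))) := by
    rw [← Real.exp_add]; congr 1; rw [hm]; ring
  have h3 : p * Real.exp (s * ((1 - p) * (a - b))) + (1 - p) * Real.exp (s * (-p * (a - b))) ≤
      1 + s ^ 2 * (p * (1 - p)) * (a - b) ^ 2 := by
    have := mul_le_mul_of_nonneg_left (hexp _ h1) hp0
    have := mul_le_mul_of_nonneg_left (hexp _ h2) (by linarith : 0 ≤ 1 - p)
    nlinarith
  have h4 : (a - b) ^ 2 ≤ d := by
    have h5 : (a - b) ^ 2 ≤ d ^ 2 := by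
      rw [← sq_abs]
      gcongr
    nlinarith
  have h5 : s ^ 2 * (p * (1 - p)) * (a - b) ^ 2 ≤ s ^ 2 * (d * p) := by
    have : p * (1 - p) * (a - b) ^ 2 ≤ p * d := by
      have : (1 - p) * (a - b) ^ 2 ≤ d := by nlinarith [sq_nonneg (a - b)]
      nlinarith
    nlinarith [sq_nonneg s]
  rw [e1, e2, Real.exp_add]
  have h6 := Real.add_one_le_exp (s ^ 2 * (d * p))
  calc _ = Real.exp (s * m) * (p * Real.exp (s * ((1 - p) * (a - b))) +
          (1 - p) * Real.exp (s * (-p * (a - b)))) := by ring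
    _ ≤ _ := by
      gcongr
      linarith

/-- Integrate out one coordinate at a time. The function is quantified inside the induction, since
the step uses the hypothesis both for `f` and for `f` with the new bit switched on. Truncated
configurations have finitely many open bits, so the Lipschitz condition is needed only there. -/
theorem mgf_truncate_le (A : Set ι) {s : ℝ} (hs : |s| ≤ 1) (S : Finset ι) :
    ∀ f : (ι → Bool) → ℝ, (∀ ω : ι → Bool, {e | ω e = true}.Finite → ∀ e,
        |f (Function.update ω e true) - f ω| ≤ A.indicator 1 e) →
      ∫ ω, Real.exp (s * f (truncate S ω)) ∂(bernoulliProduct q) ≤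
        Real.exp (s * ∫ ω, f (truncate S ω) ∂(bernoulliProduct q) +
          s ^ 2 * ∑ e ∈ S, A.indicator 1 e * (q e : ℝ)) := by
  induction S using Finset.induction_on with
  | empty =>
    intro f _
    have : ∀ ω : ι → Bool, truncate ∅ ω = fun _ => false := fun ω => by
      funext e; simp [truncate]
    simp [this]
  | insert e S he ih =>
    intro f hf
    have hd0 : (0 : ℝ) ≤ A.indicator 1 e := Set.indicator_nonneg (fun _ _ => zero_le_one) e
    have hd1 : (A.indicator 1 e : ℝ) ≤ 1 := Set.indicator_le_self' (fun _ _ => zero_le_one) e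
    have hup : ∀ ω : ι → Bool, {e | ω e = true}.Finite →
        {i | Function.update ω e true i = true}.Finite := by
      intro ω hω
      refine (hω.union (Set.finite_singleton e)).subset fun i hi => ?_
      by_cases hie : i = e
      · exact Or.inr hie
      · left
        simpa [Function.update_of_ne hie] using hi
    have ih1 := ih (fun ω => f (Function.update ω e true)) (by
      intro ω hω i
      by_cases hie : i = e
      · subst hie
        simp only [Function.update_idem, sub_self, abs_zero]
        exact Set.indicator_nonneg (fun _ _ => zero_le_one) i
      · rw [Function.update_comm hie]
        exact hf _ (hup ω hω) i)
    have ih0 := ih f hf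
    rw [integral_truncate_insert q he (fun ω => Real.exp (s * f ω)),
      integral_truncate_insert q he f]
    set m1 := ∫ ω, f (Function.update (truncate S ω) e true) ∂(bernoulliProduct q)
    set m0 := ∫ ω, f (truncate S ω) ∂(bernoulliProduct q)
    -- The Lipschitz bound survives averaging over the remaining bits, so the two conditional means
    -- form a two-point variable of small range.
    have hm : |m1 - m0| ≤ A.indicator 1 e := by
      rw [← integral_sub (integrable_comp_truncate q S fun ω => f (Function.update ω e true))
        (integrable_comp_truncate q S f)]
      have := norm_integral_le_of_norm_le_const (μ := bernoulliProduct q)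
        (f := fun ω => f (Function.update (truncate S ω) e true) - f (truncate S ω))
        (C := A.indicator 1 e)
        (Filter.Eventually.of_forall fun ω => hf _ (truncate_finite S ω) e)
      simpa using this
    have h2 := two_point_exp_le (q e).2.1 (q e).2.2 hs hd0 hd1 hm
    rw [Finset.sum_insert he]
    set T := ∑ e ∈ S, A.indicator 1 e * (q e : ℝ)
    have hp0 : (0 : ℝ) ≤ q e := (q e).2.1
    have hp1 : (0 : ℝ) ≤ 1 - q e := sub_nonneg.2 (q e).2.2
    calc _ ≤ q e * Real.exp (s * m1 + s ^ 2 * T) + (1 - q e) * Real.exp (s * m0 + s ^ 2 * T) := by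
          gcongr
      _ = (q e * Real.exp (s * m1) + (1 - q e) * Real.exp (s * m0)) * Real.exp (s ^ 2 * T) := by
          rw [Real.exp_add, Real.exp_add]; ring
      _ ≤ _ := by
          refine (mul_le_mul_of_nonneg_right h2 (Real.exp_pos _).le).trans_eq ?_
          rw [← Real.exp_add]
          congr 1
          ring

variable [Countable ι]

theorem aestronglyMeasurable_of_truncate {f : (ι → Bool) → ℝ}
    (hconv : ∀ᵐ ω ∂(bernoulliProduct q), Tendsto (fun S => f (truncate S ω)) atTop (𝓝 (f ω))) :
    AEStronglyMeasurable f (bernoulliProduct q) :=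
  aestronglyMeasurable_of_tendsto_ae atTop
    (fun S => (measurable_comp_truncate S f).aestronglyMeasurable) hconv

theorem tendsto_integral_truncate {f : (ι → Bool) → ℝ} {C : ℝ} (hC : ∀ ω, |f ω| ≤ C)
    (hconv : ∀ᵐ ω ∂(bernoulliProduct q), Tendsto (fun S => f (truncate S ω)) atTop (𝓝 (f ω))) :
    Tendsto (fun S => ∫ ω, f (truncate S ω) ∂(bernoulliProduct q)) atTop
      (𝓝 (∫ ω, f ω ∂(bernoulliProduct q))) :=
  tendsto_integral_filter_of_dominated_convergence (fun _ => C)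
    (Filter.Eventually.of_forall fun S => (measurable_comp_truncate S f).aestronglyMeasurable)
    (Filter.Eventually.of_forall fun _ => Filter.Eventually.of_forall fun _ => hC _)
    (integrable_const _) hconv

/-- Let the finite set of coordinates exhaust `ι` in `mgf_truncate_le`; boundedness of `f` justifies
dominated convergence on both sides. -/
theorem mgf_le_of_lipschitz (A : Set ι) {s M C : ℝ} (hs : |s| ≤ 1) {f : (ι → Bool) → ℝ}
    (hC : ∀ ω, |f ω| ≤ C)
    (hM : ∀ S : Finset ι, ∑ e ∈ S, A.indicator 1 e * (q e : ℝ) ≤ M)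
    (hlip : ∀ ω : ι → Bool, {e | ω e = true}.Finite → ∀ e,
        |f (Function.update ω e true) - f ω| ≤ A.indicator 1 e)
    (hconv : ∀ᵐ ω ∂(bernoulliProduct q), Tendsto (fun S => f (truncate S ω)) atTop (𝓝 (f ω))) :
    mgf f (bernoulliProduct q) s ≤
      Real.exp (s * ∫ ω, f ω ∂(bernoulliProduct q) + s ^ 2 * M) := by
  have hbd : ∀ ω, |Real.exp (s * f ω)| ≤ Real.exp C := by
    intro ω
    rw [abs_of_pos (Real.exp_pos _)]
    refine Real.exp_le_exp.2 ((le_abs_self _).trans ?_)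
    rw [abs_mul]
    exact (mul_le_of_le_one_left (abs_nonneg _) hs).trans (hC ω)
  have h1 := tendsto_integral_truncate q hbd (by
    filter_upwards [hconv] with ω hω
    exact (Real.continuous_exp.tendsto _).comp (hω.const_mul s))
  have h2 := tendsto_integral_truncate q hC hconv
  have h3 : Tendsto (fun S : Finset ι => Real.exp (s * (∫ ω, f (truncate S ω) ∂(bernoulliProduct q)) +
      s ^ 2 * M)) atTop (𝓝 (Real.exp (s * ∫ ω, f ω ∂(bernoulliProduct q) + s ^ 2 * M))) :=
    (Real.continuous_exp.tendsto _).comp ((h2.const_mul s).add_const _)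
  refine le_of_tendsto_of_tendsto' h1 h3 fun S => (mgf_truncate_le q A hs S f hlip).trans ?_
  have := hM S
  gcongr

/-- Chernoff's inequality at `s` for the upper tail and at `-s` for the lower one. -/
theorem measure_abs_sub_integral_ge_le (A : Set ι) {s M C t : ℝ} (hs0 : 0 ≤ s) (hs : s ≤ 1)
    {f : (ι → Bool) → ℝ} (hC : ∀ ω, |f ω| ≤ C)
    (hM : ∀ S : Finset ι, ∑ e ∈ S, A.indicator 1 e * (q e : ℝ) ≤ M)
    (hlip : ∀ ω : ι → Bool, {e | ω e = true}.Finite → ∀ e,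
        |f (Function.update ω e true) - f ω| ≤ A.indicator 1 e)
    (hconv : ∀ᵐ ω ∂(bernoulliProduct q), Tendsto (fun S => f (truncate S ω)) atTop (𝓝 (f ω))) :
    (bernoulliProduct q).real {ω | t ≤ |f ω - ∫ ω, f ω ∂(bernoulliProduct q)|} ≤
      2 * Real.exp (-s * t + s ^ 2 * M) := by
  set m := ∫ ω, f ω ∂(bernoulliProduct q)
  have hint : ∀ r : ℝ, Integrable (fun ω => Real.exp (r * f ω)) (bernoulliProduct q) := by
    intro r
    refine Integrable.of_bound (C := Real.exp (|r| * C)) ?_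
      (Filter.Eventually.of_forall fun ω => ?_)
    · exact Real.continuous_exp.comp_aestronglyMeasurable
        ((aestronglyMeasurable_of_truncate q hconv).const_mul r)
    · rw [Real.norm_eq_abs, abs_of_pos (Real.exp_pos _)]
      refine Real.exp_le_exp.2 ((le_abs_self _).trans ?_)
      rw [abs_mul]
      exact mul_le_mul_of_nonneg_left (hC ω) (abs_nonneg _)
  have hs' : |s| ≤ 1 := by rwa [abs_of_nonneg hs0]
  have h1 := measure_ge_le_exp_mul_mgf (μ := bernoulliProduct q) (X := f) (m + t) hs0 (hint s)
  have h2 := measure_le_le_exp_mul_mgf (μ := bernoulliProduct q) (X := f) (m - t)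
    (neg_nonpos.2 hs0) (hint (-s))
  have h3 := mgf_le_of_lipschitz q A hs' hC hM hlip hconv
  have h4 := mgf_le_of_lipschitz q A (s := -s) (by rwa [abs_neg]) hC hM hlip hconv
  have h5 : (bernoulliProduct q).real {ω | m + t ≤ f ω} ≤ Real.exp (-s * t + s ^ 2 * M) := by
    refine h1.trans ((mul_le_mul_of_nonneg_left h3 (Real.exp_pos _).le).trans_eq ?_)
    rw [← Real.exp_add]
    congr 1
    ring
  have h6 : (bernoulliProduct q).real {ω | f ω ≤ m - t} ≤ Real.exp (-s * t + s ^ 2 * M) := by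
    refine h2.trans ((mul_le_mul_of_nonneg_left h4 (Real.exp_pos _).le).trans_eq ?_)
    rw [← Real.exp_add]
    congr 1
    ring
  have hsub : {ω | t ≤ |f ω - m|} ⊆ {ω | m + t ≤ f ω} ∪ {ω | f ω ≤ m - t} := by
    intro ω hω
    rcases le_abs.1 (show t ≤ |f ω - m| from hω) with h | h
    · left; show m + t ≤ f ω; linarith
    · right; show f ω ≤ m - t; linarith
  calc _ ≤ _ := measureReal_mono hsub
    _ ≤ _ := measureReal_union_le _ _
    _ ≤ _ := by linarith

/-- Law of large numbers for functions that change by at most one when one of the relevant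
coordinates is switched on. -/
theorem ae_tendsto_sub_integral_div (A : ℕ → Set ι) {M : ℝ} {f : ℕ → (ι → Bool) → ℝ}
    {n : ℕ → ℕ} (hn : ∀ j, j < n j)
    (hC : ∀ j, ∃ C, ∀ ω, |f j ω| ≤ C)
    (hM : ∀ j, ∀ S : Finset ι, ∑ e ∈ S, (A j).indicator 1 e * (q e : ℝ) ≤ M * n j)
    (hlip : ∀ j, ∀ ω : ι → Bool, {e | ω e = true}.Finite → ∀ e,
        |f j (Function.update ω e true) - f j ω| ≤ (A j).indicator 1 e)
    (hconv : ∀ j, ∀ᵐ ω ∂(bernoulliProduct q),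
      Tendsto (fun S => f j (truncate S ω)) atTop (𝓝 (f j ω))) :
    ∀ᵐ ω ∂(bernoulliProduct q),
      Tendsto (fun j => (f j ω - ∫ ω', f j ω' ∂(bernoulliProduct q)) / n j) atTop (𝓝 0) := by
  have hM0 : 0 ≤ M := by
    have h := hM 0 ∅
    have h2 := hn 0
    rw [Finset.sum_empty] at h
    exact nonneg_of_mul_nonneg_left h (by exact_mod_cast h2)
  have key : ∀ ε : ℝ, 0 < ε → ∀ᵐ ω ∂(bernoulliProduct q), ∀ᶠ j in atTop,
      |f j ω - ∫ ω', f j ω' ∂(bernoulliProduct q)| < ε * n j := by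
    intro ε hε
    -- This `s` makes the quadratic term `s² M n` at most half of the linear gain `s ε n`, leaving
    -- the exponent `-c n` with `c = s ε / 2`. The `M + 1` covers `M = 0`.
    set s := min 1 (ε / (2 * (M + 1))) with hs
    have hs0 : 0 < s := lt_min one_pos (by positivity)
    have hs1 : s ≤ 1 := min_le_left _ _
    have hs2 : s * M ≤ ε / 2 := by
      have h1 : s ≤ ε / (2 * (M + 1)) := min_le_right _ _
      rw [le_div_iff₀ (by positivity)] at h1
      nlinarith
    set c := s * ε / 2 with hc
    have hc0 : 0 < c := by positivity
    have hbound : ∀ j, (bernoulliProduct q).real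
        {ω | ε * n j ≤ |f j ω - ∫ ω, f j ω ∂(bernoulliProduct q)|} ≤
          2 * Real.exp (-c) ^ j := by
      intro j
      obtain ⟨C, hC'⟩ := hC j
      refine (measure_abs_sub_integral_ge_le q (A j) hs0.le hs1 hC' (hM j) (hlip j)
        (hconv j)).trans ?_
      rw [← Real.exp_nat_mul]
      have hnj : (j : ℝ) ≤ n j := by exact_mod_cast (hn j).le
      have : s ^ 2 * (M * n j) ≤ s * (ε / 2) * n j := by
        have := mul_le_mul_of_nonneg_left hs2 hs0.le
        have := mul_le_mul_of_nonneg_right this (Nat.cast_nonneg (α := ℝ) (n j))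
        linarith
      have : c * j ≤ c * n j := by gcongr
      gcongr
      rw [hc] at this ⊢
      linarith
    -- Since `n j > j`, the deviation probabilities are dominated by a geometric series, and
    -- Borel–Cantelli applies.
    have hsum : (∑' j, bernoulliProduct q
        {ω | ε * n j ≤ |f j ω - ∫ ω, f j ω ∂(bernoulliProduct q)|}) ≠ ∞ := by
      have hs : Summable fun j : ℕ => 2 * Real.exp (-c) ^ j :=
        (summable_geometric_of_lt_one (Real.exp_pos _).le
          (Real.exp_lt_one_iff.2 (by linarith))).mul_left 2
      refine ne_top_of_le_ne_top hs.tsum_ofReal_ne_top (ENNReal.tsum_le_tsum fun j => ?_)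
      rw [← ofReal_measureReal]
      exact ENNReal.ofReal_le_ofReal (hbound j)
    filter_upwards [ae_eventually_notMem hsum] with ω hω
    filter_upwards [hω] with j hj
    exact not_le.1 hj
  have h2 : ∀ᵐ ω ∂(bernoulliProduct q), ∀ k : ℕ, ∀ᶠ j in atTop,
      |f j ω - ∫ ω', f j ω' ∂(bernoulliProduct q)| < (1 / ((k : ℝ) + 1)) * n j :=
    ae_all_iff.2 fun k => key _ (by positivity)
  filter_upwards [h2] with ω hω
  rw [Metric.tendsto_nhds]
  intro ε hε
  obtain ⟨k, hk⟩ := exists_nat_one_div_lt hε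
  filter_upwards [hω k] with j hj
  have hnj : (0 : ℝ) < n j := by exact_mod_cast (Nat.zero_le j).trans_lt (hn j)
  rw [dist_zero_right, Real.norm_eq_abs, abs_div, abs_of_pos hnj, div_lt_iff₀ hnj]
  refine hj.trans ?_
  gcongr

end Bernoulli

/-! ### Laplacians of graphs and their restrictions -/

section GraphLaplacian

open scoped Classical

variable {V : Type*}

theorem formalLaplacian_congr_graph {Γ Γ' : SimpleGraph V} {f : V → ℂ} {z : V}
    (h : ∀ y, f z ≠ f y → (Γ.Adj z y ↔ Γ'.Adj z y)) :
    formalLaplacian Γ f z = formalLaplacian Γ' f z := by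
  unfold formalLaplacian
  refine finsum_mem_inter_support_eq _ _ _ ?_
  ext y
  simp only [Set.mem_inter_iff, SimpleGraph.mem_neighborSet, Function.mem_support]
  refine and_congr_left fun hy => h y ?_
  exact fun h' => hy (sub_eq_zero.2 h')

theorem formalLaplacian_comp_equiv {Γ Γ' : SimpleGraph V} (e : V ≃ V)
    (h : ∀ x y, Γ'.Adj x y ↔ Γ.Adj (e x) (e y)) (f : V → ℂ) (z : V) :
    formalLaplacian Γ' (f ∘ e) z = formalLaplacian Γ f (e z) := by
  unfold formalLaplacian
  refine finsum_mem_eq_of_bijOn e ?_ fun y _ => rfl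
  refine ⟨fun y hy => (h z y).1 hy, e.injective.injOn, fun y hy => ⟨e.symm y, ?_, by simp⟩⟩
  exact (h _ _).2 (by simpa using hy)

/-- The formal Laplacian of a locally finite graph as a linear map. -/
def formalLaplacianHom {Γ : SimpleGraph V} (h : IsLocallyFinite Γ) : (V → ℂ) →ₗ[ℂ] (V → ℂ) where
  toFun := formalLaplacian Γ
  map_add' := formalLaplacian_add h
  map_smul' c f := formalLaplacian_smul c f

/-- Extension by zero from a finite set. -/
def zeroExtend (Q : Finset V) : (Q → ℂ) →ₗ[ℂ] (V → ℂ) :=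
  Function.ExtendByZero.linearMap ℂ (Subtype.val : Q → V)

theorem zeroExtend_coe {Q : Finset V} (v : Q → ℂ) (x : Q) : zeroExtend Q v x = v x :=
  Subtype.val_injective.extend_apply v 0 x

theorem zeroExtend_apply_of_mem {Q : Finset V} (v : Q → ℂ) {x : V} (hx : x ∈ Q) :
    zeroExtend Q v x = v ⟨x, hx⟩ := zeroExtend_coe v ⟨x, hx⟩

theorem zeroExtend_apply_of_notMem {Q : Finset V} (v : Q → ℂ) {x : V} (hx : x ∉ Q) :
    zeroExtend Q v x = 0 :=
  Function.extend_apply' (f := (Subtype.val : Q → V)) v 0 x (by rintro ⟨y, rfl⟩; exact hx y.2)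

theorem zeroExtend_eq_sum {Q : Finset V} (v : Q → ℂ) :
    zeroExtend Q v = ∑ y : Q, v y • (Pi.single (y : V) 1 : V → ℂ) := by
  funext x
  rw [Finset.sum_apply]
  by_cases hx : x ∈ Q
  · rw [zeroExtend_apply_of_mem v hx, Finset.sum_eq_single ⟨x, hx⟩]
    · simp
    · intro y _ hy
      have : x ≠ y := fun h => hy (Subtype.ext h.symm)
      simp [Pi.single_eq_of_ne this]
    · simp
  · rw [zeroExtend_apply_of_notMem v hx]
    symm
    refine Finset.sum_eq_zero fun y _ => ?_
    have : x ≠ y := by rintro rfl; exact hx y.2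
    simp [Pi.single_eq_of_ne this]

theorem restrictedLaplacian_mulVec {Γ : SimpleGraph V} (h : IsLocallyFinite Γ) (Q : Finset V)
    (v : Q → ℂ) (z : Q) :
    (restrictedLaplacian Γ Q).mulVec v z = formalLaplacian Γ (zeroExtend Q v) z := by
  have h1 : formalLaplacian Γ (zeroExtend Q v) = formalLaplacianHom h (zeroExtend Q v) := rfl
  rw [h1, zeroExtend_eq_sum, map_sum, Finset.sum_apply]
  simp only [Matrix.mulVec, dotProduct, map_smul, Pi.smul_apply, smul_eq_mul]
  refine Finset.sum_congr rfl fun y _ => ?_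
  rw [mul_comm]
  simp only [restrictedLaplacian, formalLaplacianHom, LinearMap.coe_mk, AddHom.coe_mk]

/-- The diagonal entries are degrees in the whole graph, so edges leaving `Q` have to agree as well.
-/
theorem restrictedLaplacian_congr {Γ Γ' : SimpleGraph V} {Q : Finset V}
    (h : ∀ x ∈ Q, ∀ y, Γ.Adj x y ↔ Γ'.Adj x y) :
    restrictedLaplacian Γ Q = restrictedLaplacian Γ' Q := by
  ext x y
  exact formalLaplacian_congr_graph fun z _ => h x x.2 z

/-- The number of eigenvalues of the restricted Laplacian that satisfy `P`. -/
def lapCount (Γ : SimpleGraph V) (Q : Finset V) (P : ℝ → Prop) : ℕ :=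
  spectralCount (restrictedLaplacian_isHermitian Γ Q) P

theorem lapCount_congr {Γ Γ' : SimpleGraph V} {Q : Finset V}
    (h : ∀ x ∈ Q, ∀ y, Γ.Adj x y ↔ Γ'.Adj x y) (P : ℝ → Prop) :
    lapCount Γ Q P = lapCount Γ' Q P := by
  unfold lapCount
  have := restrictedLaplacian_congr h
  congr!

theorem lapCount_le_card (Γ : SimpleGraph V) (Q : Finset V) (P : ℝ → Prop) :
    lapCount Γ Q P ≤ Q.card :=
  (spectralCount_le_card _ P).trans_eq (Fintype.card_coe Q)

theorem lapCount_mono (Γ : SimpleGraph V) (Q : Finset V) {P P' : ℝ → Prop} (h : ∀ x, P x → P' x) :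
    lapCount Γ Q P ≤ lapCount Γ Q P' := spectralCount_mono _ h

theorem lapCount_equiv {Γ Γ' : SimpleGraph V} (e : V ≃ V)
    (h : ∀ x y, Γ'.Adj x y ↔ Γ.Adj (e x) (e y)) {Q Q' : Finset V} (hQ : ∀ x, x ∈ Q ↔ e x ∈ Q')
    (P : ℝ → Prop) : lapCount Γ' Q P = lapCount Γ Q' P := by
  refine spectralCount_reindex _ _ (e.subtypeEquiv hQ) (fun x y => ?_) P
  have h1 : (Pi.single (y : V) 1 : V → ℂ) = (Pi.single (e y) 1 : V → ℂ) ∘ e := by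
    funext z
    simp [Pi.single_apply]
  have h2 := formalLaplacian_comp_equiv e h (Pi.single (e y) 1 : V → ℂ) x
  rw [← h1] at h2
  exact h2

/-- The vertices of `Q` that have a neighbour outside of `Q`. -/
def innerBoundary (Γ : SimpleGraph V) (Q : Finset V) : Finset V :=
  Q.filter fun x => ∃ y, y ∉ Q ∧ Γ.Adj x y

theorem innerBoundary_congr {Γ Γ' : SimpleGraph V} {Q : Finset V}
    (h : ∀ x ∈ Q, ∀ y, Γ.Adj x y ↔ Γ'.Adj x y) : innerBoundary Γ Q = innerBoundary Γ' Q := by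
  refine Finset.filter_congr fun x hx => ?_
  simp only [h x hx]

theorem innerBoundary_equiv {Γ Γ' : SimpleGraph V} (e : V ≃ V)
    (h : ∀ x y, Γ'.Adj x y ↔ Γ.Adj (e x) (e y)) {Q Q' : Finset V} (hQ : ∀ x, x ∈ Q ↔ e x ∈ Q') :
    (innerBoundary Γ' Q).card = (innerBoundary Γ Q').card := by
  refine Finset.card_bij (fun x _ => e x) ?_ (fun _ _ _ _ hxy => e.injective hxy) ?_
  · intro x hx
    simp only [innerBoundary, Finset.mem_filter] at hx ⊢
    obtain ⟨h1, y, h2, h3⟩ := hx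
    exact ⟨(hQ x).1 h1, e y, fun h4 => h2 ((hQ y).2 h4), (h _ _).1 h3⟩
  · intro x hx
    simp only [innerBoundary, Finset.mem_filter] at hx
    obtain ⟨h1, y, h2, h3⟩ := hx
    refine ⟨e.symm x, ?_, by simp⟩
    simp only [innerBoundary, Finset.mem_filter]
    refine ⟨(hQ _).2 (by simpa using h1), e.symm y, fun h4 => h2 ?_, (h _ _).2 (by simpa using h3)⟩
    simpa using (hQ _).1 h4

/-- Block comparison for the restricted Laplacian. -/
theorem abs_lapCount_sub_sum_le (Γ : SimpleGraph V) (Q : Finset V) {κ : Type*} [Fintype κ]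
    (B : κ → Finset V) (hB : ∀ i, B i ⊆ Q) (hdisj : ∀ i j, i ≠ j → Disjoint (B i) (B j)) (E : ℝ) :
    |(lapCount Γ Q (· ≤ E) : ℝ) - ∑ i, (lapCount Γ (B i) (· ≤ E) : ℝ)| ≤
      ∑ i, ((innerBoundary Γ (B i)).card : ℝ) + ((Q.card : ℝ) - ∑ i, ((B i).card : ℝ)) := by
  let φ : (Σ i, B i) → Q := fun s => ⟨s.2, hB s.1 s.2.2⟩
  have hφ : Function.Injective φ := by
    rintro ⟨i, x, hx⟩ ⟨j, y, hy⟩ hxy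
    have hxy' : x = y := congrArg Subtype.val hxy
    subst hxy'
    have hij : i = j := by
      by_contra hne
      exact Finset.disjoint_left.1 (hdisj i j hne) hx hy
    subst hij
    rfl
  let D : ∀ i, Finset (B i) := fun i => Finset.univ.filter fun x => (x : V) ∈ innerBoundary Γ (B i)
  have hcard : ∀ i, (D i).card = (innerBoundary Γ (B i)).card := by
    intro i
    rw [← Finset.card_map ⟨Subtype.val, Subtype.val_injective⟩]
    congr 1
    ext x
    simp only [D, Finset.mem_map, Finset.mem_filter, Finset.mem_univ, true_and,
      Function.Embedding.coeFn_mk, Subtype.exists, exists_and_right, exists_eq_right]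
    exact ⟨fun h => h.2, fun h => ⟨(Finset.mem_filter.1 h).1, h⟩⟩
  have hD : ∀ i j x y, i ≠ j → x ∉ D i →
      restrictedLaplacian Γ Q (φ ⟨i, x⟩) (φ ⟨j, y⟩) = 0 := by
    intro i j x y hij hx
    have hyB : (y : V) ∉ B i := fun h => Finset.disjoint_left.1 (hdisj i j hij) h y.2
    have hne : (x : V) ≠ y := fun h => hyB (h ▸ x.2)
    have hadj : ¬ Γ.Adj x y := by
      intro h
      apply hx
      simp only [D, innerBoundary, Finset.mem_filter, Finset.mem_univ, true_and]
      exact ⟨x.2, y, hyB, h⟩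
    have := formalLaplacian_single Γ (x : V) y
    rw [if_neg hne, if_neg hadj] at this
    exact this
  have h := abs_spectralCount_sub_sum_block_le (restrictedLaplacian_isHermitian Γ Q) hφ D hD
    (fun i => restrictedLaplacian_isHermitian Γ (B i)) E
  simp only [hcard, Fintype.card_coe] at h
  exact h

/-- Disjoint supports give linear independence, and an eigenfunction supported in `Q` remains one
under compression to `Q`. -/
theorem finrank_le_lapCount_eq {Γ : SimpleGraph V} (hΓ : IsLocallyFinite Γ) (Q : Finset V)
    (lam : ℝ) {κ : Type*} [Fintype κ] (u : κ → V → ℂ) (hne : ∀ i, u i ≠ 0)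
    (hsupp : ∀ i x, u i x ≠ 0 → x ∈ Q) (hdisj : ∀ i j x, i ≠ j → u i x ≠ 0 → u j x = 0)
    (heig : ∀ i, formalLaplacian Γ (u i) = (lam : ℂ) • u i) :
    Fintype.card κ ≤ lapCount Γ Q (· = lam) := by
  let v : κ → Q → ℂ := fun i x => u i x
  have hext : ∀ i, zeroExtend Q (v i) = u i := by
    intro i
    funext x
    by_cases hx : x ∈ Q
    · rw [zeroExtend_apply_of_mem _ hx]
    · rw [zeroExtend_apply_of_notMem _ hx]
      by_contra h
      exact hx (hsupp i x (Ne.symm h))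
  have hli : LinearIndependent ℂ v := by
    rw [Fintype.linearIndependent_iff]
    intro c hc i
    obtain ⟨x, hx⟩ := Function.ne_iff.1 (hne i)
    have h1 := congrFun hc ⟨x, hsupp i x hx⟩
    rw [Finset.sum_apply, Finset.sum_eq_single i] at h1
    · have h2 : c i * u i x = 0 := h1
      exact (mul_eq_zero.1 h2).resolve_right hx
    · intro j _ hj
      have : u j x = 0 := hdisj i j x hj.symm hx
      simp [v, this]
    · simp
  rw [← finrank_span_eq_card hli]
  refine finrank_le_count_eq _ fun w hw => ?_
  induction hw using Submodule.span_induction with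
  | mem w hw =>
    obtain ⟨i, rfl⟩ := hw
    funext z
    rw [restrictedLaplacian_mulVec hΓ, hext, heig]
    rfl
  | zero => simp
  | add a b _ _ ha hb => rw [Matrix.mulVec_add, ha, hb, smul_add]
  | smul c a _ ha => rw [Matrix.mulVec_smul, ha, smul_comm]

/-- Finitely supported eigenfunctions, together with zero, as a subspace of `ℓ²`. -/
def finSupportedEigenspace {Γ : SimpleGraph V} (h : IsLocallyFinite Γ) (lam : ℝ) :
    Submodule ℂ (Ell2 V) where
  carrier := {u | u ∈ finSupported V ∧ formalLaplacian Γ u = (lam : ℂ) • (u : V → ℂ)}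
  zero_mem' := by
    refine ⟨zero_mem _, ?_⟩
    rw [lp.coeFn_zero, smul_zero]
    exact map_zero (formalLaplacianHom h)
  add_mem' {f g} hf hg := by
    refine ⟨add_mem hf.1 hg.1, ?_⟩
    rw [lp.coeFn_add, formalLaplacian_add h, hf.2, hg.2, smul_add]
  smul_mem' c f hf := by
    refine ⟨Submodule.smul_mem _ c hf.1, ?_⟩
    rw [lp.coeFn_smul, formalLaplacian_smul, hf.2, smul_comm]

/-- Finitely supported functions already lie in the domain before closure, and the closure extends
the operator; on them the abstract eigenvalue equation is the pointwise one. -/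
theorem isEigenfunction_laplacian_iff {Γ : SimpleGraph V} (h : IsLocallyFinite Γ) (lam : ℝ)
    (u : Ell2 V) (hu : (Function.support (u : V → ℂ)).Finite) :
    IsEigenfunction (laplacian Γ h) lam u ↔
      u ≠ 0 ∧ formalLaplacian Γ u = (lam : ℂ) • (u : V → ℂ) := by
  have hle := (preLaplacian Γ h).le_closure
  have hdom : u ∈ (preLaplacian Γ h).domain := hu
  have hval : ∀ hu' : u ∈ (laplacian Γ h).domain,
      ((laplacian Γ h ⟨u, hu'⟩ : Ell2 V) : V → ℂ) = formalLaplacian Γ u := by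
    intro hu'
    have h1 : preLaplacian Γ h ⟨u, hdom⟩ = laplacian Γ h ⟨u, hu'⟩ := hle.2 rfl
    rw [← h1]
    rfl
  unfold IsEigenfunction
  refine and_congr_right fun _ => ⟨?_, fun h1 => ⟨hle.1 hdom, ?_⟩⟩
  · rintro ⟨hu', h1⟩
    rw [← hval hu', h1]
    rfl
  · apply lp.ext
    exact (hval _).trans h1

/-- Eigenvectors of the compression that vanish on the inner boundary extend by zero to global
eigenfunctions; the vanishing costs one dimension per boundary vertex. Finite dimensionality
excludes the default value `0` of `finrank`. -/
theorem lapCount_eq_le_finrank_add_innerBoundary {Γ : SimpleGraph V} (h : IsLocallyFinite Γ)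
    (Q : Finset V) (lam : ℝ) [FiniteDimensional ℂ (finSupportedEigenspace h lam)] :
    lapCount Γ Q (· = lam) ≤
      Module.finrank ℂ (finSupportedEigenspace h lam) + (innerBoundary Γ Q).card := by
  obtain ⟨W, h1, h2⟩ := exists_submodule_count_eq (restrictedLaplacian_isHermitian Γ Q) lam
  let D : Finset V := innerBoundary Γ Q
  let L : (Q → ℂ) →ₗ[ℂ] (D → ℂ) := (LinearMap.funLeft ℂ ℂ Subtype.val).comp (zeroExtend Q)
  have h3 := finrank_le_finrank_inf_ker_add W L
  rw [Fintype.card_coe] at h3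
  have hsub : ∀ v : Q → ℂ, Function.support (zeroExtend Q v) ⊆ Q := by
    intro v x hx
    by_contra hx'
    exact hx (zeroExtend_apply_of_notMem v hx')
  have hfin : ∀ v : Q → ℂ, (Function.support (zeroExtend Q v)).Finite := fun v =>
    Q.finite_toSet.subset (hsub v)
  have heig : ∀ v ∈ W ⊓ LinearMap.ker L,
      formalLaplacian Γ (zeroExtend Q v) = (lam : ℂ) • zeroExtend Q v := by
    rintro v ⟨hvW, hvL⟩
    funext z
    by_cases hz : z ∈ Q
    · have h4 := restrictedLaplacian_mulVec h Q v ⟨z, hz⟩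
      rw [h2 v hvW] at h4
      rw [← h4, Pi.smul_apply, Pi.smul_apply, zeroExtend_apply_of_mem v hz]
    -- Outside `Q` the Laplacian only sees neighbours in `Q`, and these are boundary vertices, where
    -- the function vanishes.
    · rw [Pi.smul_apply, zeroExtend_apply_of_notMem v hz, smul_zero]
      refine finsum_mem_eq_zero_of_forall_eq_zero fun y hy => ?_
      rw [zeroExtend_apply_of_notMem v hz, zero_sub, neg_eq_zero]
      by_cases hyQ : y ∈ Q
      · have hyD : y ∈ D := by
          simp only [D, innerBoundary, Finset.mem_filter]
          exact ⟨hyQ, z, hz, SimpleGraph.Adj.symm hy⟩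
        exact congrFun hvL ⟨y, hyD⟩
      · exact zeroExtend_apply_of_notMem v hyQ
  let Ψ : ↥(W ⊓ LinearMap.ker L) →ₗ[ℂ] finSupportedEigenspace h lam :=
    { toFun := fun v => ⟨⟨zeroExtend Q v, (memℓp_zero_iff.2 (hfin v)).of_exponent_ge (by simp)⟩,
        hfin v, heig v v.2⟩
      map_add' := fun v w => by
        apply Subtype.ext
        apply lp.ext
        exact map_add (zeroExtend Q) (v : Q → ℂ) w
      map_smul' := fun c v => by
        apply Subtype.ext
        apply lp.ext
        exact map_smul (zeroExtend Q) c (v : Q → ℂ) }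
  have hinj : Function.Injective Ψ := by
    intro v w hvw
    have h5 : zeroExtend Q (v : Q → ℂ) = zeroExtend Q (w : Q → ℂ) :=
      congrArg (fun u : finSupportedEigenspace h lam => ((u : Ell2 V) : V → ℂ)) hvw
    apply Subtype.ext
    funext x
    rw [← zeroExtend_coe (v : Q → ℂ) x, h5, zeroExtend_coe]
  have h6 := LinearMap.finrank_le_finrank_of_injective hinj
  have h7 : lapCount Γ Q (· = lam) ≤ Module.finrank ℂ W := h1
  have h8 : D.card = (innerBoundary Γ Q).card := rfl
  omega

end GraphLaplacian

/-! ### Dependence of the percolation Laplacian on the configuration -/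

section Configuration

open scoped Classical

variable {V : Type*}

theorem percGraph_adj {ω : Config V} {x y : V} :
    (percGraph ω).Adj x y ↔ ∃ h : ¬ (s(x, y)).IsDiag, ω ⟨s(x, y), h⟩ = true := Iff.rfl

/-- The edges with an endpoint in `Q`. -/
def touchingEdges (Q : Finset V) : Set (Edge V) := {e | ∃ x ∈ Q, x ∈ e.1}

theorem percGraph_adj_congr {Q : Finset V} {ω ω' : Config V}
    (h : ∀ e ∈ touchingEdges Q, ω e = ω' e) :
    ∀ x ∈ Q, ∀ y, (percGraph ω).Adj x y ↔ (percGraph ω').Adj x y := by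
  intro x hx y
  simp only [percGraph_adj]
  refine exists_congr fun hd => ?_
  rw [h ⟨s(x, y), hd⟩ ⟨x, hx, Sym2.mem_mk_left x y⟩]

theorem finite_open_touchingEdges {ω : Config V} (h : IsLocallyFinite (percGraph ω))
    (Q : Finset V) : {e | e ∈ touchingEdges Q ∧ ω e = true}.Finite := by
  have h1 : (⋃ x ∈ Q, (fun y => s(x, y)) '' (percGraph ω).neighborSet x).Finite :=
    Q.finite_toSet.biUnion fun x _ => (h x).image _
  refine Set.Finite.of_finite_image (h1.subset ?_) (Subtype.val_injective.injOn)
  rintro _ ⟨⟨e, hd⟩, ⟨⟨x, hx, hxe⟩, he⟩, rfl⟩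
  obtain ⟨y, rfl⟩ := Sym2.mem_iff_exists.1 hxe
  simp only [Set.mem_iUnion]
  exact ⟨x, hx, y, ⟨hd, he⟩, rfl⟩

/-- Only finitely many open edges touch `Q`; any `S` containing them will do. Thus local functions
are limits of their truncations. -/
theorem eventually_truncate_eq {ω : Config V} (h : IsLocallyFinite (percGraph ω)) (Q : Finset V) :
    ∀ᶠ S in atTop, ∀ e ∈ touchingEdges Q, truncate S ω e = ω e := by
  filter_upwards [eventually_ge_atTop (finite_open_touchingEdges h Q).toFinset] with S hS e he
  by_cases ho : ω e = true
  · have : e ∈ S := hS (by simpa using ⟨he, ho⟩)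
    simp [truncate, this]
  · have ho' : ω e = false := by simpa using ho
    simp [truncate, ho']

theorem tendsto_truncate_of_local {ω : Config V} (h : IsLocallyFinite (percGraph ω)) (Q : Finset V)
    {f : Config V → ℝ} (hf : ∀ ω ω', (∀ e ∈ touchingEdges Q, ω e = ω' e) → f ω = f ω') :
    Tendsto (fun S => f (truncate S ω)) atTop (𝓝 (f ω)) := by
  refine tendsto_const_nhds.congr' ?_
  filter_upwards [eventually_truncate_eq h Q] with S hS
  exact (hf _ _ hS).symm

theorem isLocallyFinite_of_finite {ω : Config V} (h : {e | ω e = true}.Finite) :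
    IsLocallyFinite (percGraph ω) := by
  intro x
  refine Set.Finite.of_finite_image ((h.image Subtype.val).subset ?_)
    (f := fun y => s(x, y)) ?_
  · rintro _ ⟨y, ⟨hd, hy⟩, rfl⟩
    exact ⟨⟨s(x, y), hd⟩, hy, rfl⟩
  · intro y _ z _ hyz
    exact Sym2.congr_right.1 hyz

theorem finite_update {ω : Config V} (h : {e | ω e = true}.Finite) (e : Edge V) :
    {i | Function.update ω e true i = true}.Finite := by
  refine (h.union (Set.finite_singleton e)).subset fun i hi => ?_
  by_cases hie : i = e
  · exact Or.inr hie
  · left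
    simpa [Function.update_of_ne hie] using hi

theorem update_eq_of_touchingEdges {Q : Finset V} {ω : Config V} {e : Edge V}
    (he : e ∉ touchingEdges Q) :
    ∀ i ∈ touchingEdges Q, Function.update ω e true i = ω i := by
  intro i hi
  refine Function.update_of_ne ?_ _ _
  rintro rfl
  exact he hi

theorem percGraph_update_adj {ω : Config V} {x y : V} (hd : ¬ (s(x, y)).IsDiag) (a b : V) :
    (percGraph (Function.update ω ⟨s(x, y), hd⟩ true)).Adj a b ↔
      (percGraph ω).Adj a b ∨ s(a, b) = s(x, y) := by
  simp only [percGraph_adj]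
  by_cases h : s(a, b) = s(x, y)
  · simp only [h, or_true, iff_true]
    exact ⟨hd, by simp⟩
  · simp only [h, or_false]
    refine exists_congr fun hd' => ?_
    rw [Function.update_of_ne]
    intro h'
    exact h (congrArg Subtype.val h')

/-- The edge `[x, y]` enters the Laplacian only through the difference `v x - v y`. Extending `v` by
zero treats endpoints outside `Q` in the same way. -/
theorem quadForm_update_eq {ω : Config V} (hω : {e | ω e = true}.Finite) (Q : Finset V) {x y : V}
    (hd : ¬ (s(x, y)).IsDiag) (v : Q → ℂ) (hv : zeroExtend Q v x = zeroExtend Q v y) :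
    quadForm (restrictedLaplacian (percGraph (Function.update ω ⟨s(x, y), hd⟩ true)) Q) v =
      quadForm (restrictedLaplacian (percGraph ω) Q) v := by
  unfold quadForm
  congr 2
  funext z
  rw [restrictedLaplacian_mulVec (isLocallyFinite_of_finite hω),
    restrictedLaplacian_mulVec (isLocallyFinite_of_finite (finite_update hω _))]
  refine formalLaplacian_congr_graph fun w hw => ?_
  rw [percGraph_update_adj]
  refine or_iff_left fun h => hw ?_
  rcases Sym2.eq_iff.1 h with ⟨h1, h2⟩ | ⟨h1, h2⟩
  · rw [h1, h2, hv]
  · rw [h1, h2, hv]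

/-- A bounded function of the configuration that depends on the edges touching `Q` only and
changes by at most one when an edge is opened. -/
structure IsLocalLipschitz (Q : Finset V) (f : Config V → ℝ) : Prop where
  bound : ∀ ω, |f ω| ≤ Q.card
  locality : ∀ ω ω', (∀ e ∈ touchingEdges Q, ω e = ω' e) → f ω = f ω'
  lipschitz : ∀ ω : Config V, {e | ω e = true}.Finite →
    ∀ e, |f (Function.update ω e true) - f ω| ≤ 1

theorem IsLocalLipschitz.abs_update_le {Q : Finset V} {f : Config V → ℝ}
    (hf : IsLocalLipschitz Q f) (ω : Config V) (hω : {e | ω e = true}.Finite) (e : Edge V) :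
    |f (Function.update ω e true) - f ω| ≤ (touchingEdges Q).indicator 1 e := by
  by_cases he : e ∈ touchingEdges Q
  · rw [Set.indicator_of_mem he]
    exact hf.lipschitz ω hω e
  · rw [Set.indicator_of_notMem he, hf.locality _ _ (update_eq_of_touchingEdges he), sub_self,
      abs_zero]

/-- Opening an edge preserves the form on the hyperplane of functions with equal values at its
endpoints. The hypothesis `hP` turns this into a change of at most one, in both directions. -/
theorem isLocalLipschitz_lapCount (Q : Finset V) (P : ℝ → Prop)
    (hP : ∀ ω : Config V, {e | ω e = true}.Finite → ∀ ω' : Config V, {e | ω' e = true}.Finite →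
      ∀ l : (Q → ℂ) →ₗ[ℂ] ℂ,
      (∀ v, l v = 0 → quadForm (restrictedLaplacian (percGraph ω) Q) v =
        quadForm (restrictedLaplacian (percGraph ω') Q) v) →
      lapCount (percGraph ω) Q P ≤ lapCount (percGraph ω') Q P + 1) :
    IsLocalLipschitz Q fun ω => (lapCount (percGraph ω) Q P : ℝ) where
  bound ω := by
    rw [abs_of_nonneg (Nat.cast_nonneg _)]
    exact_mod_cast lapCount_le_card _ _ _
  locality ω ω' h := by
    rw [lapCount_congr (percGraph_adj_congr h)]
  lipschitz ω hω e := by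
    obtain ⟨e, hd⟩ := e
    induction e using Sym2.ind with
    | _ x y =>
    let l : (Q → ℂ) →ₗ[ℂ] ℂ := 
      (LinearMap.proj (R := ℂ) (φ := fun _ : V => ℂ) x).comp (zeroExtend Q) -
        (LinearMap.proj (R := ℂ) (φ := fun _ : V => ℂ) y).comp (zeroExtend Q)
    have hl : ∀ v, l v = 0 → zeroExtend Q v x = zeroExtend Q v y := fun v hv => sub_eq_zero.1 hv
    have h1 := hP _ (finite_update hω _) ω hω l
      fun v hv => quadForm_update_eq hω Q hd v (hl v hv)
    have h2 := hP ω hω _ (finite_update hω _) l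
      fun v hv => (quadForm_update_eq hω Q hd v (hl v hv)).symm
    have h1' := (Nat.cast_le (α := ℝ)).2 h1
    have h2' := (Nat.cast_le (α := ℝ)).2 h2
    push_cast at h1' h2'
    rw [abs_le]
    constructor <;> linarith

theorem isLocalLipschitz_lapCount_le (Q : Finset V) (E : ℝ) :
    IsLocalLipschitz Q fun ω => (lapCount (percGraph ω) Q (· ≤ E) : ℝ) :=
  isLocalLipschitz_lapCount Q _ fun _ _ _ _ l h =>
    spectralCount_le_add_one_of_quadForm_eq _ _ l h E

theorem isLocalLipschitz_lapCount_lt (Q : Finset V) (E : ℝ) :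
    IsLocalLipschitz Q fun ω => (lapCount (percGraph ω) Q (· < E) : ℝ) :=
  isLocalLipschitz_lapCount Q _ fun _ _ _ _ l h =>
    spectralCount_lt_le_add_one_of_quadForm_eq _ _ l h E

theorem innerBoundary_update {ω : Config V} (Q : Finset V) (e : Edge V) :
    innerBoundary (percGraph ω) Q ⊆ innerBoundary (percGraph (Function.update ω e true)) Q ∧
    ∃ z, innerBoundary (percGraph (Function.update ω e true)) Q ⊆
      insert z (innerBoundary (percGraph ω) Q) := by
  obtain ⟨e, hd⟩ := e
  induction e using Sym2.ind with
  | _ x y =>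
  constructor
  · intro a ha
    simp only [innerBoundary, Finset.mem_filter] at ha ⊢
    obtain ⟨h1, b, h2, h3⟩ := ha
    exact ⟨h1, b, h2, (percGraph_update_adj hd a b).2 (Or.inl h3)⟩
  -- A new boundary vertex arises only if the edge joins `Q` to its complement, and then it is the
  -- endpoint in `Q`.
  · refine ⟨if x ∈ Q then x else y, fun a ha => ?_⟩
    simp only [innerBoundary, Finset.mem_filter, Finset.mem_insert] at ha ⊢
    obtain ⟨h1, b, h2, h3⟩ := ha
    rcases (percGraph_update_adj hd a b).1 h3 with h4 | h4
    · exact Or.inr ⟨h1, b, h2, h4⟩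
    · left
      rcases Sym2.eq_iff.1 h4 with ⟨rfl, rfl⟩ | ⟨rfl, rfl⟩
      · simp [h1]
      · simp [h2]

theorem isLocalLipschitz_innerBoundary (Q : Finset V) :
    IsLocalLipschitz Q fun ω => ((innerBoundary (percGraph ω) Q).card : ℝ) where
  bound ω := by
    rw [abs_of_nonneg (Nat.cast_nonneg _)]
    exact_mod_cast Finset.card_filter_le _ _
  locality ω ω' h := by
    rw [innerBoundary_congr (percGraph_adj_congr h)]
  lipschitz ω _ e := by
    obtain ⟨h1, z, h2⟩ := innerBoundary_update (ω := ω) Q e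
    have h3 := Finset.card_le_card h1
    have h4 := (Finset.card_le_card h2).trans (Finset.card_insert_le _ _)
    have h3' : ((innerBoundary (percGraph ω) Q).card : ℝ) ≤
        (innerBoundary (percGraph (Function.update ω e true)) Q).card := by exact_mod_cast h3
    have h4' : ((innerBoundary (percGraph (Function.update ω e true)) Q).card : ℝ) ≤
        (innerBoundary (percGraph ω) Q).card + 1 := by exact_mod_cast h4
    rw [abs_le]
    constructor <;> linarith

end Configuration

/-! ### Translations, tilings and mean boundaries -/

section GroupGeometry

open scoped Classical

variable {G : Type*} [Group G]

/-- The number of points of `Q` that left multiplication by `g` moves out of `Q`. -/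
def escapeCount (Q : Finset G) (g : G) : ℕ := (Q.filter fun x => g * x ∉ Q).card

theorem escapeCount_le_card (Q : Finset G) (g : G) : escapeCount Q g ≤ Q.card :=
  Finset.card_filter_le _ _

/-- Left multiplication by `g` injects the escaping points into `g Q_j \ Q_j`. -/
theorem IsFolnerSeq.tendsto_escapeCount_div {Q : ℕ → Finset G} (hQ : IsFolnerSeq Q) (g : G) :
    Tendsto (fun j => (escapeCount (Q j) g : ℝ) / (Q j).card) atTop (𝓝 0) := by
  refine squeeze_zero (fun j => by positivity) (fun j => ?_) (hQ {g})
  gcongr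
  have hfin : (((({g} : Finset G) : Set G) * (Q j : Set G)) \ (Q j : Set G)).Finite :=
    Set.Finite.sdiff (Set.Finite.mul (Finset.finite_toSet _) (Finset.finite_toSet _))
  rw [Set.ncard_eq_toFinset_card _ hfin]
  refine Finset.card_le_card_of_injOn (fun x => g * x) ?_ (mul_right_injective g).injOn
  intro x hx
  simp only [Finset.coe_filter, Set.mem_ofPred_eq] at hx
  simp only [Set.Finite.coe_toFinset]
  exact ⟨Set.mul_mem_mul (by simp) hx.1, hx.2⟩

/-- The translate `B t`. -/
def rightTranslate (B : Finset G) (t : G) : Finset G := B.map (Equiv.mulRight t).toEmbedding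

theorem mem_rightTranslate {B : Finset G} {t x : G} : x ∈ rightTranslate B t ↔ x * t⁻¹ ∈ B := by
  simp only [rightTranslate, Finset.mem_map, Equiv.coe_toEmbedding, Equiv.coe_mulRight]
  constructor
  · rintro ⟨b, hb, rfl⟩
    simpa using hb
  · exact fun h => ⟨_, h, by simp⟩

theorem mul_mem_rightTranslate {B : Finset G} {t x : G} : x * t ∈ rightTranslate B t ↔ x ∈ B := by
  simp [mem_rightTranslate]

theorem card_rightTranslate (B : Finset G) (t : G) : (rightTranslate B t).card = B.card :=
  Finset.card_map _

/-- An upper bound for the number of points of `Q` not covered by tiles `B t ⊆ Q`. -/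
def tileDefect (B Q : Finset G) : ℕ := ∑ b ∈ B, ∑ b' ∈ B, escapeCount Q (b' * b⁻¹)

theorem IsFolnerSeq.tendsto_tileDefect_div {Q : ℕ → Finset G} (hQ : IsFolnerSeq Q) (B : Finset G) :
    Tendsto (fun j => (tileDefect B (Q j) : ℝ) / (Q j).card) atTop (𝓝 0) := by
  have h : (fun j => (tileDefect B (Q j) : ℝ) / (Q j).card) = fun j =>
      ∑ b ∈ B, ∑ b' ∈ B, (escapeCount (Q j) (b' * b⁻¹) : ℝ) / (Q j).card := by
    funext j
    simp only [tileDefect, Nat.cast_sum, Finset.sum_div]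
  rw [h]
  have := tendsto_finsetSum B fun b _ => tendsto_finsetSum B fun b' _ =>
    hQ.tendsto_escapeCount_div (b' * b⁻¹)
  simpa using this

/-- Keep the tiles contained in `Q`. A point `x = b t` of `Q` in a discarded tile has some `b' t =
b' b⁻¹ x` outside `Q`, so it is counted by the escape count of `b' b⁻¹`. -/
theorem IsMonotile.exists_tiles {B : Finset G} (hB : IsMonotile B) (Q : Finset G) :
    ∃ I : Finset G, (∀ t ∈ I, rightTranslate B t ⊆ Q) ∧
      (∀ s ∈ I, ∀ t ∈ I, s ≠ t → Disjoint (rightTranslate B s) (rightTranslate B t)) ∧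
      Q.card ≤ I.card * B.card + tileDefect B Q := by
  obtain ⟨T, hcov, hdisj⟩ := hB
  have hcoe : ∀ t, (rightTranslate B t : Set G) = (B : Set G) * {t} := by
    intro t
    ext x
    rw [Finset.mem_coe, mem_rightTranslate, Set.mul_singleton]
    simp
  refine ⟨((B⁻¹ * Q).filter fun t => t ∈ T ∧ rightTranslate B t ⊆ Q), ?_, ?_, ?_⟩
  · intro t ht
    exact (Finset.mem_filter.1 ht).2.2
  · intro s hs t ht hst
    have := hdisj (Finset.mem_filter.1 hs).2.1 (Finset.mem_filter.1 ht).2.1 hst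
    rw [Function.onFun, ← hcoe, ← hcoe, Finset.disjoint_coe] at this
    exact this
  · set I := (B⁻¹ * Q).filter fun t => t ∈ T ∧ rightTranslate B t ⊆ Q with hI
    have hsub : Q ⊆ (I.biUnion fun t => rightTranslate B t) ∪
        B.biUnion fun b => B.biUnion fun b' => Q.filter fun x => b' * b⁻¹ * x ∉ Q := by
      intro x hx
      have hx' : x ∈ ⋃ t ∈ T, (B : Set G) * {t} := hcov ▸ Set.mem_univ x
      simp only [Set.mem_iUnion] at hx'
      obtain ⟨t, ht, hxt⟩ := hx'
      rw [← hcoe, Finset.mem_coe] at hxt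
      have hb := mem_rightTranslate.1 hxt
      rw [Finset.mem_union]
      by_cases hsub : rightTranslate B t ⊆ Q
      · left
        refine Finset.mem_biUnion.2 ⟨t, Finset.mem_filter.2 ⟨?_, ht, hsub⟩, hxt⟩
        have : t = (x * t⁻¹)⁻¹ * x := by group
        rw [this]
        exact Finset.mul_mem_mul (Finset.inv_mem_inv hb) hx
      · right
        obtain ⟨y, hy, hyQ⟩ := Finset.not_subset.1 hsub
        refine Finset.mem_biUnion.2 ⟨x * t⁻¹, hb, Finset.mem_biUnion.2
          ⟨y * t⁻¹, mem_rightTranslate.1 hy, Finset.mem_filter.2 ⟨hx, ?_⟩⟩⟩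
        have : y * t⁻¹ * (x * t⁻¹)⁻¹ * x = y := by group
        rwa [this]
    refine (Finset.card_le_card hsub).trans ((Finset.card_union_le _ _).trans ?_)
    refine Nat.add_le_add ?_ ?_
    · exact Finset.card_biUnion_le_card_mul _ _ _ fun t _ => (card_rightTranslate B t).le
    · refine Finset.card_biUnion_le.trans (Finset.sum_le_sum fun b _ => ?_)
      exact Finset.card_biUnion_le

/-- Too few points escape to exhaust `Q`, so some `x ∈ Q` satisfies `B x ⊆ Q`; take `t = x⁻¹`. -/
theorem exists_subset_rightTranslate {B Q : Finset G} (h : ∑ b ∈ B, escapeCount Q b < Q.card) :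
    ∃ t, B ⊆ rightTranslate Q t := by
  have h1 : ¬ Q ⊆ B.biUnion fun b => Q.filter fun x => b * x ∉ Q := by
    intro hsub
    exact ((Finset.card_le_card hsub).trans Finset.card_biUnion_le).not_gt h
  obtain ⟨x, hx, hx'⟩ := Finset.not_subset.1 h1
  refine ⟨x⁻¹, fun b hb => mem_rightTranslate.2 ?_⟩
  rw [inv_inv]
  by_contra hbx
  exact hx' (Finset.mem_biUnion.2 ⟨b, hb, Finset.mem_filter.2 ⟨hx, hbx⟩⟩)

/-- The right translate of an edge. -/
def edgeTranslate (t : G) (e : Edge G) : Edge G :=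
  ⟨e.1.map (· * t), by
    rw [Sym2.isDiag_map (mul_left_injective t)]
    exact e.2⟩

theorem edgeTranslate_injective (t : G) : Function.Injective (edgeTranslate t) := by
  intro e e' h
  exact Subtype.ext (Sym2.map.injective (mul_left_injective t) (congrArg Subtype.val h))

/-- The right translate of a configuration. -/
def translateConfig (t : G) (ω : Config G) : Config G := fun e => ω (edgeTranslate t e)

theorem percGraph_translateConfig_adj (t : G) (ω : Config G) (x y : G) :
    (percGraph (translateConfig t ω)).Adj x y ↔ (percGraph ω).Adj (x * t) (y * t) := by
  simp only [percGraph_adj, translateConfig, edgeTranslate, Sym2.map_mk]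
  refine ⟨fun ⟨h, h'⟩ => ⟨?_, h'⟩, fun ⟨h, h'⟩ => ⟨?_, h'⟩⟩
  · simpa using h
  · simpa using h

theorem lapCount_rightTranslate (ω : Config G) (B : Finset G) (t : G) (P : ℝ → Prop) :
    lapCount (percGraph ω) (rightTranslate B t) P =
      lapCount (percGraph (translateConfig t ω)) B P :=
  (lapCount_equiv (Equiv.mulRight t) (percGraph_translateConfig_adj t ω)
    (fun _ => mul_mem_rightTranslate.symm) P).symm

theorem card_innerBoundary_rightTranslate (ω : Config G) (B : Finset G) (t : G) :
    (innerBoundary (percGraph ω) (rightTranslate B t)).card =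
      (innerBoundary (percGraph (translateConfig t ω)) B).card :=
  (innerBoundary_equiv (Equiv.mulRight t) (percGraph_translateConfig_adj t ω)
    (fun _ => mul_mem_rightTranslate.symm)).symm

variable (p : EdgeProfile G)

theorem EdgeProfile.law_eq : p.law = bernoulliProduct (fun e : Edge G => p.edgeProb e.1) := rfl

instance : IsProbabilityMeasure p.law := by
  rw [p.law_eq]
  infer_instance

theorem EdgeProfile.edgeProb_mk (x y : G) : p.edgeProb s(x, y) = p.prob (x * y⁻¹) := rfl

/-- Stationarity: `(x t) (y t)⁻¹ = x y⁻¹`, so right translation permutes independent bits with equal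
parameters. -/
theorem EdgeProfile.measurePreserving_translateConfig (t : G) :
    MeasurePreserving (translateConfig t) p.law p.law := by
  refine ⟨by unfold translateConfig; fun_prop, ?_⟩
  have h := Measure.map_infinitePi_infinitePi_of_inj
    (P := fun e : Edge G => bernoulliMeasure true false (p.edgeProb e.1))
    (edgeTranslate_injective t)
  have h2 : (fun e : Edge G => bernoulliMeasure true false (p.edgeProb (edgeTranslate t e).1)) =
      fun e : Edge G => bernoulliMeasure true false (p.edgeProb e.1) := by
    funext ⟨e, he⟩
    induction e using Sym2.ind with
    | _ x y =>
    congr 1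
    simp only [edgeTranslate, Sym2.map_mk, EdgeProfile.edgeProb_mk]
    congr 1
    group
  rw [h2] at h
  exact h

/-- An edge at `x` is determined by its other endpoint `y`, hence by `x y⁻¹`, so no value of `p` is
used twice. -/
theorem EdgeProfile.sum_mem_edge_le (x : G) (S : Finset (Edge G)) :
    ∑ e ∈ S.filter (fun e => x ∈ e.1), (p.edgeProb e.1 : ℝ) ≤ ∑' g, (p.prob g : ℝ) := by
  have hother : ∀ e : Edge G, x ∈ e.1 → ∃ y, e.1 = s(x, y) := fun e he => Sym2.mem_iff_exists.1 he
  let y : Edge G → G := fun e => if h : x ∈ e.1 then (hother e h).choose else x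
  have hy : ∀ e : Edge G, x ∈ e.1 → e.1 = s(x, y e) := by
    intro e he
    simp only [y, dif_pos he]
    exact (hother e he).choose_spec
  have hinj : Set.InjOn (fun e => x * (y e)⁻¹) (S.filter (fun e : Edge G => x ∈ e.1)) := by
    intro e he e' he' h
    have h1 : y e = y e' := by simpa using h
    apply Subtype.ext
    rw [hy e (Finset.mem_filter.1 he).2, hy e' (Finset.mem_filter.1 he').2, h1]
  calc _ = ∑ e ∈ S.filter (fun e : Edge G => x ∈ e.1), (p.prob (x * (y e)⁻¹) : ℝ) := by
        refine Finset.sum_congr rfl fun e he => ?_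
        rw [← p.edgeProb_mk, ← hy e (Finset.mem_filter.1 he).2]
    _ = ∑ g ∈ (S.filter (fun e : Edge G => x ∈ e.1)).image (fun e => x * (y e)⁻¹),
          (p.prob g : ℝ) := by rw [Finset.sum_image hinj]
    _ ≤ _ := p.summable.sum_le_tsum _ fun g _ => (p.prob g).2.1

theorem EdgeProfile.sum_touchingEdges_le (Q : Finset G) (S : Finset (Edge G)) :
    ∑ e ∈ S, (touchingEdges Q).indicator 1 e * (p.edgeProb e.1 : ℝ) ≤
      (∑' g, (p.prob g : ℝ)) * Q.card := by
  have h1 : ∀ e ∈ S, (touchingEdges Q).indicator 1 e * (p.edgeProb e.1 : ℝ) ≤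
      ∑ x ∈ Q, if x ∈ e.1 then (p.edgeProb e.1 : ℝ) else 0 := by
    intro e _
    have h0 : ∀ x ∈ Q, 0 ≤ if x ∈ e.1 then (p.edgeProb e.1 : ℝ) else 0 := by
      intro x _
      split_ifs
      · exact (p.edgeProb e.1).2.1
      · exact le_rfl
    by_cases he : e ∈ touchingEdges Q
    · rw [Set.indicator_of_mem he, Pi.one_apply, one_mul]
      obtain ⟨x, hx, hxe⟩ := he
      refine le_trans ?_ (Finset.single_le_sum h0 hx)
      rw [if_pos hxe]
    · rw [Set.indicator_of_notMem he, zero_mul]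
      exact Finset.sum_nonneg h0
  refine (Finset.sum_le_sum h1).trans ?_
  rw [Finset.sum_comm]
  have h2 : ∀ x ∈ Q, ∑ e ∈ S, (if x ∈ e.1 then (p.edgeProb e.1 : ℝ) else 0) ≤
      ∑' g, (p.prob g : ℝ) := by
    intro x _
    rw [← Finset.sum_filter]
    exact p.sum_mem_edge_le x S
  refine (Finset.sum_le_card_nsmul _ _ _ h2).trans_eq ?_
  rw [nsmul_eq_mul, mul_comm]

theorem measurableSet_adj {V : Type*} (x y : V) :
    MeasurableSet {ω : Config V | (percGraph ω).Adj x y} := by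
  simp only [percGraph_adj]
  by_cases hd : (s(x, y)).IsDiag
  · simp [hd]
  · simp only [hd, not_false_eq_true, exists_true_left]
    exact measurableSet_eq_fun (measurable_pi_apply _) measurable_const

theorem EdgeProfile.law_adj_le (x y : G) :
    p.law {ω | (percGraph ω).Adj x y} ≤ ENNReal.ofReal (p.prob (x * y⁻¹)) := by
  simp only [percGraph_adj]
  by_cases hd : (s(x, y)).IsDiag
  · simp [hd]
  · simp only [hd, not_false_eq_true, exists_true_left]
    rw [p.law_eq, bernoulliProduct_eval, p.edgeProb_mk]

/-- The substitution `y = g⁻¹ x`. -/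
def invMulEquiv (x : G) : G ≃ G := (Equiv.inv G).trans (Equiv.mulRight x)

theorem mul_inv_invMulEquiv (x g : G) : x * (invMulEquiv x g)⁻¹ = g := by
  simp [invMulEquiv]

theorem EdgeProfile.tsum_prob_mul_inv (x : G) (f : G → ℝ → ℝ≥0∞) :
    ∑' y, f y (p.prob (x * y⁻¹)) = ∑' g, f (g⁻¹ * x) (p.prob g) := by
  rw [← (invMulEquiv x).tsum_eq]
  simp only [mul_inv_invMulEquiv]
  rfl

/-- The expected degree of each vertex is at most `‖p‖₁`; apply Borel–Cantelli at each of countably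
many vertices. -/
theorem EdgeProfile.ae_isLocallyFinite [Countable G] :
    ∀ᵐ ω ∂p.law, IsLocallyFinite (percGraph ω) := by
  refine ae_all_iff.2 fun x => ?_
  refine ae_finite_setOfPred_mem (s := fun y => {ω : Config G | (percGraph ω).Adj x y}) ?_
  refine ne_top_of_le_ne_top p.summable.tsum_ofReal_ne_top
    ((ENNReal.tsum_le_tsum fun y => p.law_adj_le x y).trans_eq ?_)
  exact p.tsum_prob_mul_inv x fun _ => ENNReal.ofReal

theorem EdgeProfile.law_exists_adj_le [Countable G] (Q : Finset G) (x : G) :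
    p.law {ω | ∃ y, y ∉ Q ∧ (percGraph ω).Adj x y} ≤
      ∑' g, if g⁻¹ * x ∉ Q then ENNReal.ofReal (p.prob g) else 0 := by
  have h1 : {ω : Config G | ∃ y, y ∉ Q ∧ (percGraph ω).Adj x y} =
      ⋃ y, {ω : Config G | y ∉ Q ∧ (percGraph ω).Adj x y} := by
    ext ω
    simp
  rw [h1, ← p.tsum_prob_mul_inv x fun y r => if y ∉ Q then ENNReal.ofReal r else 0]
  refine (measure_iUnion_le _).trans (ENNReal.tsum_le_tsum fun y => ?_)
  by_cases hy : y ∈ Q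
  · simp [hy]
  · simpa [hy] using p.law_adj_le x y

theorem measurableSet_exists_adj {V : Type*} [Countable V] (Q : Finset V) (x : V) :
    MeasurableSet {ω : Config V | ∃ y, y ∉ Q ∧ (percGraph ω).Adj x y} := by
  have h1 : {ω : Config V | ∃ y, y ∉ Q ∧ (percGraph ω).Adj x y} =
      ⋃ y, ⋃ _ : y ∉ Q, {ω : Config V | (percGraph ω).Adj x y} := by
    ext ω
    simp
  rw [h1]
  exact MeasurableSet.iUnion fun y => MeasurableSet.iUnion fun _ => measurableSet_adj x y

theorem measurable_card_innerBoundary {V : Type*} [Countable V] (Q : Finset V) :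
    Measurable fun ω : Config V => ((innerBoundary (percGraph ω) Q).card : ℝ) := by
  simp only [innerBoundary, Finset.card_filter, Nat.cast_sum, Nat.cast_ite, Nat.cast_one,
    Nat.cast_zero]
  exact Finset.measurable_sum _ fun x _ =>
    Measurable.ite (measurableSet_exists_adj Q x) measurable_const measurable_const

/-- Union bound over the outer neighbours `y = g⁻¹ x`; interchanging the sums, each `g` is counted
once for every `x ∈ Q` with `g⁻¹ x ∉ Q`. -/
theorem EdgeProfile.lintegral_innerBoundary_le [Countable G] (Q : Finset G) :
    ∫⁻ ω, ((innerBoundary (percGraph ω) Q).card : ℝ≥0∞) ∂p.law ≤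
      ∑' g, ENNReal.ofReal (p.prob g * escapeCount Q g⁻¹) := by
  have h1 : ∀ ω : Config G, ((innerBoundary (percGraph ω) Q).card : ℝ≥0∞) =
      ∑ x ∈ Q, Set.indicator {ω : Config G | ∃ y, y ∉ Q ∧ (percGraph ω).Adj x y} 1 ω := by
    intro ω
    simp only [innerBoundary, Finset.card_filter, Nat.cast_sum, Nat.cast_ite, Nat.cast_one,
      Nat.cast_zero, Set.indicator_apply, Set.mem_ofPred_eq, Pi.one_apply]
  simp only [h1]
  rw [lintegral_finsetSum _ fun x _ => measurable_one.indicator (measurableSet_exists_adj Q x)]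
  simp only [lintegral_indicator_one (measurableSet_exists_adj Q _)]
  refine (Finset.sum_le_sum fun x _ => p.law_exists_adj_le Q x).trans_eq ?_
  rw [← Summable.tsum_finsetSum fun x _ => ENNReal.summable]
  refine tsum_congr fun g => ?_
  rw [← Finset.sum_filter, Finset.sum_const, nsmul_eq_mul, mul_comm,
    ENNReal.ofReal_mul (p.prob g).2.1, ENNReal.ofReal_natCast]
  rfl

theorem EdgeProfile.summable_escape (Q : Finset G) :
    Summable fun g => (p.prob g : ℝ) * escapeCount Q g⁻¹ := by
  refine Summable.of_nonneg_of_le (fun g => mul_nonneg (p.prob g).2.1 (Nat.cast_nonneg _))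
    (fun g => ?_) (p.summable.mul_right (Q.card : ℝ))
  refine mul_le_mul_of_nonneg_left ?_ (p.prob g).2.1
  exact_mod_cast escapeCount_le_card _ _

theorem EdgeProfile.integral_innerBoundary_le [Countable G] (Q : Finset G) :
    ∫ ω, ((innerBoundary (percGraph ω) Q).card : ℝ) ∂p.law ≤
      ∑' g, (p.prob g : ℝ) * escapeCount Q g⁻¹ := by
  have h0 : ∀ g, 0 ≤ (p.prob g : ℝ) * escapeCount Q g⁻¹ :=
    fun g => mul_nonneg (p.prob g).2.1 (Nat.cast_nonneg _)
  rw [integral_eq_lintegral_of_nonneg_ae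
    (Filter.Eventually.of_forall fun ω => Nat.cast_nonneg _)
    (measurable_card_innerBoundary Q).aestronglyMeasurable]
  refine ENNReal.toReal_le_of_le_ofReal (tsum_nonneg h0) ?_
  rw [ENNReal.ofReal_tsum_of_nonneg h0 (p.summable_escape Q)]
  simp only [ENNReal.ofReal_natCast]
  exact p.lintegral_innerBoundary_le Q

/-- Each escape ratio tends to zero by the Følner property and is at most one; `p` itself dominates
the series. -/
theorem EdgeProfile.tendsto_integral_innerBoundary_div [Countable G] {Q : ℕ → Finset G}
    (hQ : IsFolnerSeq Q) :
    Tendsto (fun j => (∫ ω, ((innerBoundary (percGraph ω) (Q j)).card : ℝ) ∂p.law) / (Q j).card)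
      atTop (𝓝 0) := by
  have h1 : Tendsto (fun j => ∑' g, (p.prob g : ℝ) * (escapeCount (Q j) g⁻¹ / (Q j).card : ℝ))
      atTop (𝓝 (∑' _ : G, (0 : ℝ))) := by
    refine tendsto_tsum_of_dominated_convergence p.summable (fun g => ?_)
      (Filter.Eventually.of_forall fun j g => ?_)
    · simpa using (hQ.tendsto_escapeCount_div g⁻¹).const_mul (p.prob g : ℝ)
    · rw [Real.norm_eq_abs, abs_of_nonneg (mul_nonneg (p.prob g).2.1 (by positivity))]
      refine mul_le_of_le_one_right (p.prob g).2.1 (div_le_one_of_le₀ ?_ (Nat.cast_nonneg _))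
      exact_mod_cast escapeCount_le_card _ _
  rw [tsum_zero] at h1
  refine squeeze_zero (fun j => ?_) (fun j => ?_) h1
  · exact div_nonneg (integral_nonneg fun _ => Nat.cast_nonneg _) (Nat.cast_nonneg _)
  · simp only [← mul_div_assoc]
    rw [tsum_div_const]
    gcongr
    exact p.integral_innerBoundary_le (Q j)

end GroupGeometry

/-! ### Convergence of distribution functions -/

section RealAnalysis

/-- A sequence of functions that is uniformly Cauchy converges uniformly. -/
theorem exists_tendstoUniformly_of_cauchy {a : ℕ → ℝ → ℝ}
    (h : ∀ ε > 0, ∃ J, ∀ i ≥ J, ∀ j ≥ J, ∀ x, |a i x - a j x| ≤ ε) :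
    ∃ N : ℝ → ℝ, TendstoUniformly a N atTop := by
  have h1 : ∀ x, CauchySeq fun j => a j x := by
    intro x
    rw [Metric.cauchySeq_iff]
    intro ε hε
    obtain ⟨J, hJ⟩ := h (ε / 2) (by positivity)
    refine ⟨J, fun i hi j hj => ?_⟩
    rw [Real.dist_eq]
    linarith [hJ i hi j hj x]
  choose N hN using fun x => cauchySeq_tendsto_of_complete (h1 x)
  refine ⟨N, ?_⟩
  rw [Metric.tendstoUniformly_iff]
  intro ε hε
  obtain ⟨J, hJ⟩ := h (ε / 2) (by positivity)
  filter_upwards [eventually_ge_atTop J] with j hj x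
  have h2 : Tendsto (fun i => |a i x - a j x|) atTop (𝓝 |N x - a j x|) :=
    ((hN x).sub_const _).abs
  have h3 : |N x - a j x| ≤ ε / 2 :=
    le_of_tendsto h2 (by filter_upwards [eventually_ge_atTop J] with i hi using hJ i hi j hj x)
  rw [Real.dist_eq]
  linarith

/-- Glivenko–Cantelli criterion: it suffices to control the functions at the quantiles of the
limit. The functions `fm j` are the left limits of the `f j`. -/
theorem tendstoUniformly_of_quantiles {f fm : ℕ → ℝ → ℝ} {N : ℝ → ℝ} {x : ℝ → ℝ}
    (hf : ∀ j, Monotone (f j)) (hfm : ∀ j y z, y < z → f j y ≤ fm j z)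
    (hf0 : ∀ j y, 0 ≤ f j y) (hf1 : ∀ j y, f j y ≤ 1) (hN : Monotone N) (hN0 : ∀ y, 0 ≤ N y)
    (hN1 : ∀ y, N y ≤ 1) (hx : ∀ r, 0 < r → r < 1 → r ≤ N (x r))
    (hx' : ∀ r, 0 < r → r < 1 → ∀ y < x r, N y < r)
    (h : ∀ r : ℚ, 0 < r → r < 1 → ∀ ε > 0, ∀ᶠ j in atTop,
      r - ε ≤ f j (x r) ∧ fm j (x r) ≤ r + ε) :
    TendstoUniformly f N atTop := by
  rw [Metric.tendstoUniformly_iff]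
  intro ε hε
  obtain ⟨m, hm⟩ := exists_nat_gt (4 / ε)
  have hm0 : (0 : ℝ) < m := lt_trans (by positivity) hm
  have hm1 : 1 / (m : ℝ) < ε / 4 := by
    rw [div_lt_iff₀ hm0]
    rw [div_lt_iff₀ hε] at hm
    linarith
  have hlt1 : ∀ k, k < m → (k : ℝ) / m < 1 := fun k hk => by
    rw [div_lt_one hm0]; exact_mod_cast hk
  have hlt0 : ∀ k : ℕ, 0 < k → 0 < (k : ℝ) / m := fun k hk => by positivity
  have hev : ∀ᶠ j in atTop, ∀ k ∈ Finset.range m, 0 < k →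
      (k : ℝ) / m - ε / 4 ≤ f j (x (k / m)) ∧ fm j (x (k / m)) ≤ (k : ℝ) / m + ε / 4 := by
    rw [Filter.eventually_all_finset]
    intro k hk
    rw [Filter.eventually_imp_distrib_left]
    intro hk0
    have hmQ : (0 : ℚ) < m := by exact_mod_cast hm0
    have h1 := h (k / m) (by positivity)
      ((div_lt_one hmQ).2 (by exact_mod_cast Finset.mem_range.1 hk)) (ε / 4) (by positivity)
    push_cast at h1
    exact h1
  filter_upwards [hev] with j hj y
  rw [Real.dist_eq, abs_lt]
  constructor
  -- The first grid level strictly above `N y`: its quantile lies to the right of `y`, so `f j y` is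
  -- bounded by the left limit there. If the level is at least one, `f j ≤ 1` suffices.
  · set k := ⌊N y * m⌋₊ + 1 with hk
    have h1 : N y < k / m := by
      rw [lt_div_iff₀ hm0, hk]
      push_cast
      exact Nat.lt_floor_add_one _
    have h2 : (k : ℝ) / m ≤ N y + 1 / m := by
      rw [div_le_iff₀ hm0, add_mul, one_div_mul_cancel hm0.ne', hk]
      push_cast
      gcongr
      exact Nat.floor_le (mul_nonneg (hN0 y) hm0.le)
    rcases lt_or_ge k m with hkm | hkm
    · have hy : y < x (k / m) := by
        by_contra! hle
        exact (((hx _ (hlt0 k (Nat.succ_pos _)) (hlt1 k hkm)).trans (hN hle)).trans_lt h1).false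
      linarith [(hj k (Finset.mem_range.2 hkm) (Nat.succ_pos _)).2, hfm j _ _ hy]
    · have : (1 : ℝ) ≤ k / m := by
        rw [le_div_iff₀ hm0, one_mul]
        exact_mod_cast hkm
      linarith [hf1 j y]
  · rcases le_or_gt (N y) (1 / m) with h0 | h0
    · linarith [hf0 j y]
    -- The last grid level strictly below `N y`: its quantile is at most `y`, so monotonicity of `f
    -- j` gives the lower bound.
    · set k := ⌈N y * m⌉₊ - 1 with hk
      have hc : 1 < ⌈N y * m⌉₊ := by
        rw [Nat.lt_ceil, Nat.cast_one]
        rwa [div_lt_iff₀ hm0] at h0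
      have hk1 : k + 1 = ⌈N y * m⌉₊ := by omega
      have hk0 : 0 < k := by omega
      have h1 : (k : ℝ) / m < N y := by
        rw [div_lt_iff₀ hm0, ← Nat.lt_ceil]
        omega
      have h2 : N y ≤ k / m + 1 / m := by
        rw [← add_div, le_div_iff₀ hm0]
        refine (Nat.le_ceil _).trans ?_
        rw [← hk1]
        push_cast
        exact le_rfl
      have hkm : k < m := by
        have : (k : ℝ) < m := by
          rw [← div_lt_one hm0]
          exact h1.trans_le (hN1 y)
        exact_mod_cast this
      have hy : x (k / m) ≤ y := by
        by_contra! hlt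
        exact (h1.trans (hx' _ (hlt0 k hk0) (hlt1 k hkm) _ hlt)).false
      linarith [(hj k (Finset.mem_range.2 hkm) hk0).1, hf j hy]

/-- A uniform limit of step functions is continuous at a point iff the jumps there vanish in the
limit. -/
theorem continuousAt_iff_tendsto_jump {f : ℕ → ℝ → ℝ} {N : ℝ → ℝ} {d : ℕ → ℝ} {x : ℝ}
    (h : TendstoUniformly f N atTop) (hd : ∀ j, 0 ≤ d j)
    (hleft : ∀ j, ∃ y₀ < x, ∀ y, y₀ ≤ y → y < x → f j y = f j x - d j)
    (hright : ∀ j, ∃ y₀ > x, ∀ y, x ≤ y → y < y₀ → f j y = f j x) :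
    ContinuousAt N x ↔ Tendsto d atTop (𝓝 0) := by
  rw [Metric.tendstoUniformly_iff] at h
  constructor
  · intro hc
    rw [Metric.tendsto_atTop]
    intro ε hε
    obtain ⟨δ, hδ, hN⟩ := Metric.continuousAt_iff.1 hc (ε / 3) (by positivity)
    obtain ⟨J, hJ⟩ := eventually_atTop.1 (h (ε / 3) (by positivity))
    refine ⟨J, fun j hj => ?_⟩
    obtain ⟨y₀, hy₀, hy⟩ := hleft j
    -- A point left of `x` that is close enough both for continuity of `N` and for seeing the full
    -- jump `d j`.
    obtain ⟨y, h1, h2⟩ := exists_between (max_lt hy₀ (sub_lt_self x hδ))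
    have h3 := hN (x := y) (by
      rw [Real.dist_eq, abs_lt]
      constructor <;> linarith [le_max_right y₀ (x - δ)])
    have h4 := hy y ((le_max_left _ _).trans h1.le) h2
    have h5 := hJ j hj y
    have h6 := hJ j hj x
    rw [Real.dist_eq, abs_lt] at h3 h5 h6
    rw [dist_zero_right, Real.norm_eq_abs, abs_of_nonneg (hd j)]
    linarith
  · intro hc
    rw [Metric.continuousAt_iff]
    intro ε hε
    obtain ⟨J₁, hJ₁⟩ := eventually_atTop.1 (h (ε / 3) (by positivity))
    obtain ⟨J₂, hJ₂⟩ := Metric.tendsto_atTop.1 hc (ε / 3) (by positivity)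
    set j := max J₁ J₂
    have hU := hJ₁ j (le_max_left _ _)
    have hdj := hJ₂ j (le_max_right _ _)
    rw [dist_zero_right, Real.norm_eq_abs, abs_of_nonneg (hd j)] at hdj
    obtain ⟨y₀, hy₀, hy⟩ := hleft j
    obtain ⟨y₁, hy₁, hy'⟩ := hright j
    refine ⟨min (x - y₀) (y₁ - x), lt_min (by linarith) (by linarith), fun {z} hz => ?_⟩
    rw [Real.dist_eq, abs_lt] at hz
    have hz1 := min_le_left (x - y₀) (y₁ - x)
    have hz2 := min_le_right (x - y₀) (y₁ - x)
    have h5 := hU z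
    have h6 := hU x
    rw [Real.dist_eq, abs_lt] at h5 h6 ⊢
    have hd0 := hd j
    rcases lt_or_ge z x with hzx | hzx
    · have := hy z (by linarith) hzx
      constructor <;> linarith
    · have := hy' z hzx (by linarith)
      constructor <;> linarith

end RealAnalysis

/-! ### Countability of finitely generated groups -/

section Countability

theorem countable_of_group_fg (G : Type*) [Group G] [Group.FG G] : Countable G := by
  obtain ⟨α, _, φ, hφ⟩ := Group.fg_iff_exists_freeGroup_hom_surjective_finite.1
    (inferInstance : Group.FG G)
  exact hφ.countable

end Countability

/-! ### Mean eigenvalue counts and the integrated density of states -/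

section DensityOfStates

open scoped Classical

variable {G : Type*} [Group G] (p : EdgeProfile G)

/-- The mean number of eigenvalues that satisfy `P`. -/
def meanCount (Q : Finset G) (P : ℝ → Prop) : ℝ :=
  ∫ ω, (lapCount (percGraph ω) Q P : ℝ) ∂p.law

/-- The mean size of the inner boundary. -/
def meanBoundary (Q : Finset G) : ℝ :=
  ∫ ω, ((innerBoundary (percGraph ω) Q).card : ℝ) ∂p.law

theorem meanCount_nonneg (Q : Finset G) (P : ℝ → Prop) : 0 ≤ meanCount p Q P :=
  integral_nonneg fun _ => Nat.cast_nonneg _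

theorem integral_translateConfig {f : Config G → ℝ} (hf : AEStronglyMeasurable f p.law) (t : G) :
    ∫ ω, f (translateConfig t ω) ∂p.law = ∫ ω, f ω ∂p.law := by
  have h := p.measurePreserving_translateConfig t
  conv_rhs => rw [← h.map_eq]
  rw [integral_map h.measurable.aemeasurable (by rwa [h.map_eq])]

theorem integral_le_card {Q : Finset G} {f : Config G → ℝ} (hf : ∀ ω, |f ω| ≤ Q.card) :
    ∫ ω, f ω ∂p.law ≤ Q.card := by
  have := norm_integral_le_of_norm_le_const (μ := p.law) (f := f) (C := Q.card)
    (Filter.Eventually.of_forall hf)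
  rw [Real.norm_eq_abs, probReal_univ, mul_one] at this
  exact (le_abs_self _).trans this

theorem meanCount_le_card (Q : Finset G) (P : ℝ → Prop) : meanCount p Q P ≤ Q.card := by
  refine integral_le_card p fun ω => ?_
  rw [abs_of_nonneg (Nat.cast_nonneg _)]
  exact_mod_cast lapCount_le_card _ _ _

variable [Countable G]

theorem IsLocalLipschitz.ae_tendsto_truncate {Q : Finset G} {f : Config G → ℝ}
    (hf : IsLocalLipschitz Q f) :
    ∀ᵐ ω ∂p.law, Tendsto (fun S => f (truncate S ω)) atTop (𝓝 (f ω)) := by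
  filter_upwards [p.ae_isLocallyFinite] with ω hω
  exact tendsto_truncate_of_local hω Q hf.locality

theorem IsLocalLipschitz.aestronglyMeasurable {Q : Finset G} {f : Config G → ℝ}
    (hf : IsLocalLipschitz Q f) : AEStronglyMeasurable f p.law :=
  aestronglyMeasurable_of_truncate _ (hf.ae_tendsto_truncate p)

theorem IsLocalLipschitz.integrable {Q : Finset G} {f : Config G → ℝ}
    (hf : IsLocalLipschitz Q f) : Integrable f p.law :=
  Integrable.of_bound (hf.aestronglyMeasurable p) _ (Filter.Eventually.of_forall hf.bound)

theorem IsLocalLipschitz.ae_tendsto_sub_integral_div {Q : ℕ → Finset G} {f : ℕ → Config G → ℝ}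
    (hf : ∀ j, IsLocalLipschitz (Q j) (f j)) (hQ : ∀ j, j < (Q j).card) :
    ∀ᵐ ω ∂p.law, Tendsto (fun j => (f j ω - ∫ ω', f j ω' ∂p.law) / (Q j).card) atTop (𝓝 0) :=
  _root_.ae_tendsto_sub_integral_div (fun e : Edge G => p.edgeProb e.1)
    (fun j => touchingEdges (Q j)) hQ (fun j => ⟨_, (hf j).bound⟩)
    (fun j => p.sum_touchingEdges_le (Q j)) (fun j ω hω e => by convert (hf j).abs_update_le ω hω e)
    fun j => (hf j).ae_tendsto_truncate p

theorem meanCount_mono {Q : Finset G} {E E' : ℝ} (h : E ≤ E') :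
    meanCount p Q (· ≤ E) ≤ meanCount p Q (· ≤ E') := by
  refine integral_mono ((isLocalLipschitz_lapCount_le Q E).integrable p)
    ((isLocalLipschitz_lapCount_le Q E').integrable p) fun ω => ?_
  exact Nat.cast_le.2 (lapCount_mono _ _ fun x hx => hx.trans h)

theorem meanCount_rightTranslate (B : Finset G) (t : G) (E : ℝ) :
    meanCount p (rightTranslate B t) (· ≤ E) = meanCount p B (· ≤ E) := by
  unfold meanCount
  simp only [lapCount_rightTranslate]
  exact integral_translateConfig p
    (f := fun ω => (lapCount (percGraph ω) B (· ≤ E) : ℝ))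
    ((isLocalLipschitz_lapCount_le B E).aestronglyMeasurable p) t

theorem meanBoundary_rightTranslate (B : Finset G) (t : G) :
    meanBoundary p (rightTranslate B t) = meanBoundary p B := by
  unfold meanBoundary
  simp only [card_innerBoundary_rightTranslate]
  exact integral_translateConfig p
    (f := fun ω => ((innerBoundary (percGraph ω) B).card : ℝ))
    ((isLocalLipschitz_innerBoundary B).aestronglyMeasurable p) t

/-- Expectation of the block comparison; by stationarity all tiles have the same mean count and mean
boundary. -/
theorem abs_meanCount_sub_le {B Q I : Finset G} (hsub : ∀ t ∈ I, rightTranslate B t ⊆ Q)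
    (hdisj : ∀ s ∈ I, ∀ t ∈ I, s ≠ t → Disjoint (rightTranslate B s) (rightTranslate B t))
    (E : ℝ) :
    |meanCount p Q (· ≤ E) - I.card * meanCount p B (· ≤ E)| ≤
      I.card * meanBoundary p B + (Q.card - I.card * B.card) := by
  have hpt : ∀ ω : Config G, |(lapCount (percGraph ω) Q (· ≤ E) : ℝ) -
      ∑ t ∈ I, (lapCount (percGraph ω) (rightTranslate B t) (· ≤ E) : ℝ)| ≤
      ∑ t ∈ I, ((innerBoundary (percGraph ω) (rightTranslate B t)).card : ℝ) +
        (Q.card - I.card * B.card) := by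
    intro ω
    have h := abs_lapCount_sub_sum_le (percGraph ω) Q (fun t : I => rightTranslate B t)
      (fun t => hsub t t.2) (fun s t hst => hdisj s s.2 t t.2 fun h => hst (Subtype.ext h)) E
    simp only [card_rightTranslate, Finset.sum_const, Finset.card_univ, Fintype.card_coe,
      nsmul_eq_mul] at h
    rw [Finset.sum_coe_sort I (fun t => (lapCount (percGraph ω) (rightTranslate B t) (· ≤ E) : ℝ)),
      Finset.sum_coe_sort I
        (fun t => ((innerBoundary (percGraph ω) (rightTranslate B t)).card : ℝ))] at h
    exact h
  have hi1 : ∀ R : Finset G, Integrable (fun ω => (lapCount (percGraph ω) R (· ≤ E) : ℝ)) p.law :=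
    fun R => (isLocalLipschitz_lapCount_le R E).integrable p
  have hi2 : ∀ R : Finset G,
      Integrable (fun ω => ((innerBoundary (percGraph ω) R).card : ℝ)) p.law :=
    fun R => (isLocalLipschitz_innerBoundary R).integrable p
  have hs1 := integrable_finsetSum I fun t _ => hi1 (rightTranslate B t)
  have hs2 := integrable_finsetSum I fun t _ => hi2 (rightTranslate B t)
  have e1 : meanCount p Q (· ≤ E) - I.card * meanCount p B (· ≤ E) =
      ∫ ω, ((lapCount (percGraph ω) Q (· ≤ E) : ℝ) -
        ∑ t ∈ I, (lapCount (percGraph ω) (rightTranslate B t) (· ≤ E) : ℝ)) ∂p.law := by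
    rw [integral_sub (hi1 Q) hs1, integral_finsetSum _ fun t _ => hi1 (rightTranslate B t)]
    have : ∀ t ∈ I, ∫ ω, (lapCount (percGraph ω) (rightTranslate B t) (· ≤ E) : ℝ) ∂p.law =
        meanCount p B (· ≤ E) := fun t _ => meanCount_rightTranslate p B t E
    rw [Finset.sum_congr rfl this, Finset.sum_const, nsmul_eq_mul]
    rfl
  have e2 : I.card * meanBoundary p B + (Q.card - I.card * B.card) =
      ∫ ω, (∑ t ∈ I, ((innerBoundary (percGraph ω) (rightTranslate B t)).card : ℝ) +
        (Q.card - I.card * B.card)) ∂p.law := by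
    rw [integral_add hs2 (integrable_const _), integral_finsetSum _ fun t _ => hi2 _]
    have : ∀ t ∈ I, ∫ ω, ((innerBoundary (percGraph ω) (rightTranslate B t)).card : ℝ) ∂p.law =
        meanBoundary p B := fun t _ => meanBoundary_rightTranslate p B t
    rw [Finset.sum_congr rfl this, Finset.sum_const, nsmul_eq_mul]
    simp
  rw [e1, e2]
  exact (abs_integral_le_integral_abs).trans
    (integral_mono ((hi1 Q).sub hs1).abs (hs2.add (integrable_const _)) hpt)

/-- The tile defect enters twice: for the uncovered points in the block comparison, and for
replacing the number of tiles by `|Q| / |B|`. -/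
theorem abs_meanCount_div_sub_le {B Q : Finset G} (hB : IsMonotile B) (hB0 : 0 < B.card)
    (hQ0 : 0 < Q.card) (E : ℝ) :
    |meanCount p Q (· ≤ E) / Q.card - meanCount p B (· ≤ E) / B.card| ≤
      meanBoundary p B / B.card + 2 * (tileDefect B Q / Q.card) := by
  obtain ⟨I, h1, h2, h3⟩ := hB.exists_tiles Q
  have h4 := abs_meanCount_sub_le p h1 h2 E
  have hcard : I.card * B.card ≤ Q.card := by
    have : (I.biUnion fun t => rightTranslate B t).card = I.card * B.card := by
      rw [Finset.card_biUnion h2]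
      simp [card_rightTranslate]
    rw [← this]
    exact Finset.card_le_card (Finset.biUnion_subset.2 h1)
  have hB0' : (0 : ℝ) < B.card := by exact_mod_cast hB0
  have hQ0' : (0 : ℝ) < Q.card := by exact_mod_cast hQ0
  have hcard' : (I.card : ℝ) * B.card ≤ Q.card := by exact_mod_cast hcard
  have h3' : (Q.card : ℝ) ≤ I.card * B.card + tileDefect B Q := by exact_mod_cast h3
  have hb0 : 0 ≤ meanBoundary p B := integral_nonneg fun _ => Nat.cast_nonneg _
  have ha1 := meanCount_le_card p B (· ≤ E)
  have ha0 := meanCount_nonneg p B (· ≤ E)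
  set a := meanCount p B (· ≤ E)
  set aQ := meanCount p Q (· ≤ E)
  set b := meanBoundary p B
  set D : ℝ := (tileDefect B Q : ℝ)
  have h5 : |aQ - Q.card * (a / B.card)| ≤ Q.card * (b / B.card) + 2 * D := by
    have e1 : (Q.card : ℝ) * (a / B.card) - I.card * a =
        (Q.card - I.card * B.card) * (a / B.card) := by
      field_simp
    have e2 : (I.card : ℝ) * b ≤ Q.card * (b / B.card) := by
      rw [mul_div_assoc', le_div_iff₀ hB0']
      nlinarith
    have e3 : a / B.card ≤ 1 := (div_le_one hB0').2 ha1
    have e4 : 0 ≤ a / B.card := by positivity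
    have e5 : (Q.card - I.card * B.card) * (a / B.card) ≤ Q.card - I.card * (B.card : ℝ) :=
      mul_le_of_le_one_right (by linarith) e3
    have e6 : 0 ≤ (Q.card - I.card * B.card) * (a / B.card) := mul_nonneg (by linarith) e4
    rw [abs_le] at h4 ⊢
    constructor <;> linarith
  have h6 : aQ / Q.card - a / B.card = (aQ - Q.card * (a / B.card)) / Q.card := by
    field_simp
  rw [h6, abs_div, abs_of_pos hQ0', div_le_iff₀ hQ0']
  refine h5.trans_eq ?_
  field_simp

/-- Fix one tile `Q_k` with small relative mean boundary; all sufficiently late `Q_j` are compared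
with it, hence with each other, uniformly in the energy. -/
theorem exists_tendstoUniformly_meanCount {Q : ℕ → Finset G} (hF : IsFolnerSeq Q)
    (hT : ∀ j, IsMonotile (Q j)) (hQ : ∀ j, 0 < (Q j).card) :
    ∃ N : ℝ → ℝ,
      TendstoUniformly (fun j E => meanCount p (Q j) (· ≤ E) / (Q j).card) N atTop := by
  refine exists_tendstoUniformly_of_cauchy fun ε hε => ?_
  have h1 := p.tendsto_integral_innerBoundary_div hF
  obtain ⟨k, hk⟩ := (h1.eventually_lt_const (u := ε / 4) (by positivity)).exists
  obtain ⟨J, hJ⟩ := eventually_atTop.1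
    ((hF.tendsto_tileDefect_div (Q k)).eventually_lt_const (u := ε / 8) (by positivity))
  have hk' : meanBoundary p (Q k) / (Q k).card < ε / 4 := hk
  have key : ∀ j ≥ J, ∀ E, |meanCount p (Q j) (· ≤ E) / (Q j).card -
      meanCount p (Q k) (· ≤ E) / (Q k).card| ≤ ε / 2 := by
    intro j hj E
    have := abs_meanCount_div_sub_le p (hT k) (hQ k) (hQ j) E
    linarith [hJ j hj]
  refine ⟨J, fun i hi j hj E => ?_⟩
  have h3 := key i hi E
  have h4 := key j hj E
  rw [abs_le] at h3 h4 ⊢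
  constructor <;> linarith

/-- Dominated convergence in a form that yields right continuity, left limits and the behaviour at
`±∞` of the mean counting functions. -/
theorem tendsto_meanCount {Q : Finset G} {c : ℕ → ℝ} {P : ℝ → Prop}
    (h : ∀ ω : Config G, ∀ᶠ n in atTop,
      lapCount (percGraph ω) Q (· ≤ c n) = lapCount (percGraph ω) Q P) :
    Tendsto (fun n => meanCount p Q (· ≤ c n)) atTop (𝓝 (meanCount p Q P)) := by
  refine tendsto_integral_of_dominated_convergence (fun _ => (Q.card : ℝ))
    (fun n => (isLocalLipschitz_lapCount_le Q (c n)).aestronglyMeasurable p)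
    (integrable_const _)
    (fun n => Filter.Eventually.of_forall (isLocalLipschitz_lapCount_le Q (c n)).bound)
    (Filter.Eventually.of_forall fun ω => ?_)
  refine tendsto_const_nhds.congr' ?_
  filter_upwards [h ω] with n hn
  rw [hn]

theorem tendsto_meanCount_add (Q : Finset G) (E : ℝ) :
    Tendsto (fun n : ℕ => meanCount p Q (· ≤ E + 1 / ((n : ℝ) + 1))) atTop
      (𝓝 (meanCount p Q (· ≤ E))) := by
  refine tendsto_meanCount p fun ω => ?_
  obtain ⟨E₀, h0, h1⟩ :=
    exists_gt_spectralCount_le_eq (restrictedLaplacian_isHermitian (percGraph ω) Q) E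
  obtain ⟨n₀, hn₀⟩ := exists_nat_one_div_lt (sub_pos.2 h0)
  filter_upwards [eventually_ge_atTop n₀] with n hn
  have h2 : 1 / ((n : ℝ) + 1) ≤ 1 / ((n₀ : ℝ) + 1) := by gcongr
  have h3 : 0 < 1 / ((n : ℝ) + 1) := by positivity
  exact h1 _ (by linarith) (by linarith)

theorem tendsto_meanCount_sub (Q : Finset G) (E : ℝ) :
    Tendsto (fun n : ℕ => meanCount p Q (· ≤ E - 1 / ((n : ℝ) + 1))) atTop
      (𝓝 (meanCount p Q (· < E))) := by
  refine tendsto_meanCount p fun ω => ?_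
  obtain ⟨E₀, h0, h1⟩ :=
    exists_lt_spectralCount_lt_eq (restrictedLaplacian_isHermitian (percGraph ω) Q) E
  obtain ⟨n₀, hn₀⟩ := exists_nat_one_div_lt (sub_pos.2 h0)
  filter_upwards [eventually_ge_atTop n₀] with n hn
  have h2 : 1 / ((n : ℝ) + 1) ≤ 1 / ((n₀ : ℝ) + 1) := by gcongr
  have h3 : 0 < 1 / ((n : ℝ) + 1) := by positivity
  exact h1 _ (by linarith) (by linarith)

theorem tendsto_meanCount_natCast (Q : Finset G) :
    Tendsto (fun n : ℕ => meanCount p Q (· ≤ (n : ℝ))) atTop (𝓝 Q.card) := by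
  have h : meanCount p Q (fun _ => True) = Q.card := by
    have : ∀ ω : Config G, lapCount (percGraph ω) Q (fun _ => True) = Q.card := by
      intro ω
      simp [lapCount, spectralCount]
    simp [meanCount, this]
  rw [← h]
  refine tendsto_meanCount p fun ω => ?_
  exact eventually_spectralCount_natCast _

theorem tendsto_meanCount_neg_natCast (Q : Finset G) :
    Tendsto (fun n : ℕ => meanCount p Q (· ≤ -(n : ℝ))) atTop (𝓝 0) := by
  have h : meanCount p Q (fun _ => False) = 0 := by
    have : ∀ ω : Config G, lapCount (percGraph ω) Q (fun _ => False) = 0 := by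
      intro ω
      simp [lapCount, spectralCount]
    simp [meanCount, this]
  rw [← h]
  refine tendsto_meanCount p fun ω => ?_
  exact eventually_spectralCount_neg_natCast _

variable {p}

/-- Uniform convergence transfers right continuity and the limits `0` and `1` at `∓∞` from the mean
distribution functions to `N`; the quantile is the infimum of `{E | r ≤ N E}`, attained by right
continuity. -/
theorem exists_quantile {Q : ℕ → Finset G} (hQ : ∀ j, 0 < (Q j).card) {N : ℝ → ℝ}
    (hN : TendstoUniformly (fun j E => meanCount p (Q j) (· ≤ E) / (Q j).card) N atTop)
    {r : ℝ} (hr0 : 0 < r) (hr1 : r < 1) : ∃ x, r ≤ N x ∧ ∀ y < x, N y < r := by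
  rw [Metric.tendstoUniformly_iff] at hN
  have hQ' : ∀ j, (0 : ℝ) < (Q j).card := fun j => by exact_mod_cast hQ j
  set S := {E | r ≤ N E} with hS
  have hne : S.Nonempty := by
    obtain ⟨j, hj⟩ := (hN ((1 - r) / 2) (by linarith)).exists
    have h1 := (tendsto_meanCount_natCast p (Q j)).div_const ((Q j).card : ℝ)
    rw [div_self (hQ' j).ne'] at h1
    obtain ⟨n, hn⟩ := (h1.eventually_const_lt (u := 1 - (1 - r) / 2) (by linarith)).exists
    refine ⟨n, ?_⟩
    have h2 := hj n
    rw [Real.dist_eq, abs_lt] at h2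
    show r ≤ N n
    linarith
  have hbdd : ∃ z, N z < r ∧ ∀ E ∈ S, z ≤ E := by
    obtain ⟨j, hj⟩ := (hN (r / 2) (by linarith)).exists
    have h1 := (tendsto_meanCount_neg_natCast p (Q j)).div_const ((Q j).card : ℝ)
    rw [zero_div] at h1
    obtain ⟨n, hn⟩ := (h1.eventually_lt_const (u := r / 2) (by linarith)).exists
    have key : ∀ E ≤ -(n : ℝ), N E < r := by
      intro E hE
      have h2 := hj E
      rw [Real.dist_eq, abs_lt] at h2
      have h3 : meanCount p (Q j) (· ≤ E) / (Q j).card ≤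
          meanCount p (Q j) (· ≤ -(n : ℝ)) / (Q j).card := by
        gcongr
        exact meanCount_mono p hE
      linarith
    refine ⟨-n, key _ le_rfl, fun E hE => ?_⟩
    by_contra! hlt
    exact (key E hlt.le).not_ge hE
  obtain ⟨z, -, hz⟩ := hbdd
  have hbb : BddBelow S := ⟨z, fun E hE => hz E hE⟩
  refine ⟨sInf S, ?_, fun y hy => ?_⟩
  · refine le_of_forall_pos_sub_le fun ε hε => ?_
    obtain ⟨j, hj⟩ := (hN (ε / 2) (by positivity)).exists
    have h1 := (tendsto_meanCount_add p (Q j) (sInf S)).div_const ((Q j).card : ℝ)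
    have h2 : r - ε / 2 ≤ meanCount p (Q j) (· ≤ sInf S) / (Q j).card := by
      refine ge_of_tendsto' h1 fun n => ?_
      have hlt : sInf S < sInf S + 1 / ((n : ℝ) + 1) := by
        have : 0 < 1 / ((n : ℝ) + 1) := by positivity
        linarith
      obtain ⟨s, hs, hs'⟩ := exists_lt_of_csInf_lt hne hlt
      have h3 := hj s
      rw [Real.dist_eq, abs_lt] at h3
      have h4 : r ≤ N s := hs
      have h5 : meanCount p (Q j) (· ≤ s) / (Q j).card ≤
          meanCount p (Q j) (· ≤ sInf S + 1 / ((n : ℝ) + 1)) / (Q j).card := by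
        gcongr
        exact meanCount_mono p hs'.le
      linarith
    have h3 := hj (sInf S)
    rw [Real.dist_eq, abs_lt] at h3
    linarith
  · by_contra! hle
    exact (csInf_le hbb hle).not_gt hy

/-- Almost sure uniform convergence of the normalised counting functions to the limit of their
means. -/
theorem ae_tendstoUniformly_lapCount {Q : ℕ → Finset G} (hQ : ∀ j, j < (Q j).card) {N : ℝ → ℝ}
    (hN : TendstoUniformly (fun j E => meanCount p (Q j) (· ≤ E) / (Q j).card) N atTop) :
    ∀ᵐ ω ∂p.law, TendstoUniformly
      (fun j E => (lapCount (percGraph ω) (Q j) (· ≤ E) : ℝ) / (Q j).card) N atTop := by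
  have hQ0 : ∀ j, 0 < (Q j).card := fun j => (Nat.zero_le j).trans_lt (hQ j)
  have hQ' : ∀ j, (0 : ℝ) < (Q j).card := fun j => by exact_mod_cast hQ0 j
  have hpt : ∀ E, Tendsto (fun j => meanCount p (Q j) (· ≤ E) / (Q j).card) atTop (𝓝 (N E)) :=
    fun E => hN.tendsto_at E
  have hex : ∀ r : ℝ, ∃ x, 0 < r → r < 1 → r ≤ N x ∧ ∀ y < x, N y < r := by
    intro r
    by_cases h : 0 < r ∧ r < 1
    · obtain ⟨x, hx⟩ := exists_quantile hQ0 hN h.1 h.2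
      exact ⟨x, fun _ _ => hx⟩
    · exact ⟨0, fun h0 h1 => absurd ⟨h0, h1⟩ h⟩
  choose x hx using hex
  -- Restricting to rational levels leaves countably many exceptional null sets.
  have hae : ∀ᵐ ω ∂p.law, ∀ r : ℚ,
      Tendsto (fun j => ((lapCount (percGraph ω) (Q j) (· ≤ x r) : ℝ) -
        meanCount p (Q j) (· ≤ x r)) / (Q j).card) atTop (𝓝 0) ∧
      Tendsto (fun j => ((lapCount (percGraph ω) (Q j) (· < x r) : ℝ) -
        meanCount p (Q j) (· < x r)) / (Q j).card) atTop (𝓝 0) := by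
    refine ae_all_iff.2 fun r => ?_
    filter_upwards [IsLocalLipschitz.ae_tendsto_sub_integral_div p
        (fun j => isLocalLipschitz_lapCount_le (Q j) (x r)) hQ,
      IsLocalLipschitz.ae_tendsto_sub_integral_div p
        (fun j => isLocalLipschitz_lapCount_lt (Q j) (x r)) hQ] with ω h1 h2
    exact ⟨h1, h2⟩
  filter_upwards [hae] with ω hω
  refine tendstoUniformly_of_quantiles
    (fm := fun j E => (lapCount (percGraph ω) (Q j) (· < E) : ℝ) / (Q j).card) (x := x)
    ?_ ?_ (fun j y => by positivity) ?_ ?_ ?_ ?_ (fun r h0 h1 => (hx r h0 h1).1)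
    (fun r h0 h1 => (hx r h0 h1).2) ?_
  · intro j y z hyz
    have : lapCount (percGraph ω) (Q j) (· ≤ y) ≤ lapCount (percGraph ω) (Q j) (· ≤ z) :=
      lapCount_mono _ _ fun _ h => h.trans hyz
    exact div_le_div_of_nonneg_right (Nat.cast_le.2 this) (hQ' j).le
  · intro j y z hyz
    have : lapCount (percGraph ω) (Q j) (· ≤ y) ≤ lapCount (percGraph ω) (Q j) (· < z) :=
      lapCount_mono _ _ fun _ h => h.trans_lt hyz
    exact div_le_div_of_nonneg_right (Nat.cast_le.2 this) (hQ' j).le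
  · intro j y
    rw [div_le_one (hQ' j)]
    exact_mod_cast lapCount_le_card _ _ _
  · intro y z hyz
    refine le_of_tendsto_of_tendsto' (hpt y) (hpt z) fun j => ?_
    gcongr
    exact meanCount_mono p hyz
  · exact fun y => ge_of_tendsto' (hpt y) fun j => div_nonneg (meanCount_nonneg _ _ _) (hQ' j).le
  · exact fun y => le_of_tendsto' (hpt y) fun j => (div_le_one (hQ' j)).2 (meanCount_le_card _ _ _)
  · intro r hr0 hr1 ε hε
    obtain ⟨h1, h2⟩ := hω r
    obtain ⟨h3, h4⟩ := hx r (by exact_mod_cast hr0) (by exact_mod_cast hr1)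
    rw [Metric.tendstoUniformly_iff] at hN
    filter_upwards [hN (ε / 2) (by positivity),
      h1.eventually_const_lt (u := -(ε / 2)) (by linarith),
      h2.eventually_lt_const (u := ε / 2) (by positivity)] with j hj hj1 hj2
    rw [sub_div] at hj1 hj2
    constructor
    · have := hj (x r)
      rw [Real.dist_eq, abs_lt] at this
      linarith
    -- The mean of the strict count is the left limit of the mean counting functions, and `N` is
    -- below `r` left of the quantile.
    · have h5 : meanCount p (Q j) (· < x r) / (Q j).card ≤ r + ε / 2 := by
        refine le_of_tendsto' ((tendsto_meanCount_sub p (Q j) (x r)).div_const _) fun n => ?_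
        have hlt : x r - 1 / ((n : ℝ) + 1) < x r := by
          have : 0 < 1 / ((n : ℝ) + 1) := by positivity
          linarith
        have h6 := h4 _ hlt
        have h7 := hj (x r - 1 / ((n : ℝ) + 1))
        rw [Real.dist_eq, abs_lt] at h7
        linarith
      linarith

end DensityOfStates

/-! ### Discontinuities of the integrated density of states -/

section Discontinuities

open scoped Classical

theorem lapCount_lt_add_eq {V : Type*} (Γ : SimpleGraph V) (Q : Finset V) (E : ℝ) :
    (lapCount Γ Q (· ≤ E) : ℝ) = lapCount Γ Q (· < E) + lapCount Γ Q (· = E) := by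
  exact_mod_cast (spectralCount_lt_add_eq (restrictedLaplacian_isHermitian Γ Q) E).symm

/-- The counting functions are right continuous steps whose jump at `lam` is the multiplicity of
`lam`. -/
theorem continuousAt_iff_tendsto_lapCount_eq {V : Type*} {Γ : SimpleGraph V} {Q : ℕ → Finset V}
    {N : ℝ → ℝ}
    (h : TendstoUniformly (fun j E => (lapCount Γ (Q j) (· ≤ E) : ℝ) / (Q j).card) N atTop)
    (lam : ℝ) :
    ContinuousAt N lam ↔
      Tendsto (fun j => (lapCount Γ (Q j) (· = lam) : ℝ) / (Q j).card) atTop (𝓝 0) := by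
  refine continuousAt_iff_tendsto_jump h (fun j => by positivity) (fun j => ?_) (fun j => ?_)
  · obtain ⟨E₀, h0, h1⟩ :=
      exists_lt_spectralCount_lt_eq (restrictedLaplacian_isHermitian Γ (Q j)) lam
    refine ⟨E₀, h0, fun y hy hy' => ?_⟩
    have h2 : lapCount Γ (Q j) (· ≤ y) = lapCount Γ (Q j) (· < lam) := h1 y hy hy'
    rw [h2, lapCount_lt_add_eq Γ (Q j) lam]
    ring
  · obtain ⟨E₀, h0, h1⟩ :=
      exists_gt_spectralCount_le_eq (restrictedLaplacian_isHermitian Γ (Q j)) lam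
    refine ⟨E₀, h0, fun y hy hy' => ?_⟩
    have h2 : lapCount Γ (Q j) (· ≤ y) = lapCount Γ (Q j) (· ≤ lam) := h1 y hy hy'
    rw [h2]

/-- If the eigenspaces of the restrictions are not negligible but the boundaries are, there are
infinitely many independent finitely supported eigenfunctions. -/
theorem exists_linearIndependent_eigenfunctions {V : Type*} {Γ : SimpleGraph V}
    (hΓ : IsLocallyFinite Γ) {Q : ℕ → Finset V}
    (hQ : Tendsto (fun j => ((Q j).card : ℝ)) atTop atTop)
    (hbd : Tendsto (fun j => ((innerBoundary Γ (Q j)).card : ℝ) / (Q j).card) atTop (𝓝 0))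
    {lam : ℝ}
    (h : ¬ Tendsto (fun j => (lapCount Γ (Q j) (· = lam) : ℝ) / (Q j).card) atTop (𝓝 0)) :
    ∃ u : ℕ → Ell2 V, LinearIndependent ℂ u ∧
      ∀ n, IsEigenfunction (laplacian Γ hΓ) lam (u n) ∧
        (Function.support (u n : V → ℂ)).Finite := by
  -- A finite dimension plus the boundary size would bound the multiplicities by `o(|Q_j|)`.
  have hinf : ¬ FiniteDimensional ℂ (finSupportedEigenspace hΓ lam) := by
    intro hfin
    refine h (squeeze_zero (fun j => by positivity) (fun j => ?_)
      ((hQ.const_div_atTop (Module.finrank ℂ (finSupportedEigenspace hΓ lam) : ℝ)).add hbd |>.trans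
        (by rw [add_zero])))
    rw [← add_div]
    gcongr
    exact_mod_cast lapCount_eq_le_finrank_add_innerBoundary hΓ (Q j) lam
  let b := Module.Basis.ofVectorSpace ℂ (finSupportedEigenspace hΓ lam)
  have hb : Infinite (Module.Basis.ofVectorSpaceIndex ℂ (finSupportedEigenspace hΓ lam)) := by
    by_contra hfin
    rw [not_infinite_iff_finite] at hfin
    exact hinf (Module.Finite.of_basis b)
  let φ := Infinite.natEmbedding (Module.Basis.ofVectorSpaceIndex ℂ (finSupportedEigenspace hΓ lam))
  have hli : LinearIndependent ℂ fun n => ((b (φ n) : finSupportedEigenspace hΓ lam) : Ell2 V) :=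
    (b.linearIndependent.comp φ φ.injective).map' (finSupportedEigenspace hΓ lam).subtype
      (Submodule.ker_subtype _)
  refine ⟨fun n => (b (φ n) : Ell2 V), hli, fun n => ?_⟩
  have hfin : (Function.support ((b (φ n) : Ell2 V) : V → ℂ)).Finite := (b (φ n)).2.1
  exact ⟨(isEigenfunction_laplacian_iff hΓ lam _ hfin).2 ⟨hli.ne_zero n, (b (φ n)).2.2⟩, hfin⟩

/-- The configurations whose open edges touching `B` are exactly those in `F`. -/
def openPattern {V : Type*} (B : Finset V) (F : Finset (Edge V)) : Set (Config V) :=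
  {ω | ∀ e, e ∈ touchingEdges B → (ω e = true ↔ e ∈ F)}

theorem exists_mem_openPattern {V : Type*} {ω : Config V} (h : IsLocallyFinite (percGraph ω))
    (B : Finset V) : ∃ F, ω ∈ openPattern B F := by
  refine ⟨(finite_open_touchingEdges h B).toFinset, fun e he => ?_⟩
  simp [he]

theorem measurableSet_openPattern {V : Type*} [Countable V] (B : Finset V) (F : Finset (Edge V)) :
    MeasurableSet (openPattern B F) := by
  have h : openPattern B F = ⋂ e, ⋂ _ : e ∈ touchingEdges B,
      {ω : Config V | ω e = true ↔ e ∈ F} := by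
    ext ω
    simp [openPattern]
  rw [h]
  refine MeasurableSet.iInter fun e => MeasurableSet.iInter fun _ => ?_
  have h1 : MeasurableSet {ω : Config V | ω e = true} :=
    measurableSet_eq_fun (measurable_pi_apply e) measurable_const
  by_cases he : e ∈ F
  · simpa [he] using h1
  · have h2 : {ω : Config V | ω e = true ↔ e ∈ F} = {ω : Config V | ω e = true}ᶜ := by
      ext ω
      simp [he]
    rw [h2]
    exact h1.compl

theorem formalLaplacian_eq_of_openPattern {V : Type*} {B : Finset V} {F : Finset (Edge V)}
    {ω ω' : Config V} (h : ω ∈ openPattern B F) (h' : ω' ∈ openPattern B F) {u : V → ℂ}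
    (hu : ∀ x, u x ≠ 0 → x ∈ B) :
    formalLaplacian (percGraph ω') u = formalLaplacian (percGraph ω) u := by
  have hag : ∀ e ∈ touchingEdges B, ω' e = ω e := fun e he => by
    rw [Bool.eq_iff_iff, h e he, h' e he]
  funext z
  refine formalLaplacian_congr_graph fun y hy => ?_
  by_cases hz : u z = 0
  · have hy' : u y ≠ 0 := fun h0 => hy (hz.trans h0.symm)
    rw [SimpleGraph.adj_comm, percGraph_adj_congr hag y (hu y hy') z, SimpleGraph.adj_comm]
  · exact percGraph_adj_congr hag z (hu z hz) y

variable {G : Type*} [Group G]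

/-- Since `B s⁻¹ t ⊆ D t`, each tile has room for a copy of `u`. Wherever the translated
configuration lies in `C`, that copy is an eigenfunction, and copies in different tiles have
disjoint supports. -/
theorem card_translates_le_lapCount_eq {ω : Config G} (hω : IsLocallyFinite (percGraph ω))
    {B D Q I : Finset G} {s : G} (hB : B ⊆ rightTranslate D s)
    (hsub : ∀ t ∈ I, rightTranslate D t ⊆ Q)
    (hdisj : ∀ r ∈ I, ∀ t ∈ I, r ≠ t → Disjoint (rightTranslate D r) (rightTranslate D t))
    {u : G → ℂ} (hu : ∀ x, u x ≠ 0 → x ∈ B) (hu0 : u ≠ 0) {lam : ℝ} {C : Set (Config G)}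
    (hC : ∀ ω' ∈ C, formalLaplacian (percGraph ω') u = (lam : ℂ) • u) :
    (I.filter fun t => translateConfig (s⁻¹ * t) ω ∈ C).card ≤
      lapCount (percGraph ω) Q (· = lam) := by
  set I' := I.filter fun t => translateConfig (s⁻¹ * t) ω ∈ C
  have hmem : ∀ t x, u (x * (s⁻¹ * t)⁻¹) ≠ 0 → x ∈ rightTranslate D t := by
    intro t x hx
    have h1 := mem_rightTranslate.1 (hB (hu _ hx))
    rw [mem_rightTranslate]
    have h2 : x * (s⁻¹ * t)⁻¹ * s⁻¹ = x * t⁻¹ := by group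
    rwa [h2] at h1
  have h := finrank_le_lapCount_eq hω Q lam (fun (t : I') x => u (x * (s⁻¹ * t)⁻¹)) ?_ ?_ ?_ ?_
  · rwa [Fintype.card_coe] at h
  · intro t h0
    apply hu0
    funext x
    simpa only [mul_inv_cancel_right, Pi.zero_apply] using congrFun h0 (x * (s⁻¹ * t))
  · intro t x hx
    exact hsub t (Finset.mem_filter.1 t.2).1 (hmem t x hx)
  · intro r t x hrt hx
    by_contra hx'
    exact Finset.disjoint_left.1 (hdisj r (Finset.mem_filter.1 r.2).1 t (Finset.mem_filter.1 t.2).1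
      fun h => hrt (Subtype.ext h)) (hmem r x hx) (hmem t x hx')
  · intro t
    have h1 := hC _ (Finset.mem_filter.1 t.2).2
    funext x
    have h2 := formalLaplacian_comp_equiv (Equiv.mulRight (s⁻¹ * (t : G)))
      (percGraph_translateConfig_adj (s⁻¹ * (t : G)) ω)
      (fun x => u (x * (s⁻¹ * (t : G))⁻¹)) (x * (s⁻¹ * (t : G))⁻¹)
    have h3 : (fun x => u (x * (s⁻¹ * (t : G))⁻¹)) ∘ (Equiv.mulRight (s⁻¹ * (t : G))) = u := by
      funext y
      simp only [Function.comp_apply, Equiv.coe_mulRight, mul_inv_cancel_right]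
    rw [h3, h1] at h2
    simp only [Equiv.coe_mulRight, inv_mul_cancel_right] at h2
    exact h2.symm

variable [Countable G] (p : EdgeProfile G)

/-- There are countably many pairs of finite sets, so the union of the null patterns is null.
Neither an eigenvalue nor an eigenfunction enters. -/
theorem ae_law_openPattern_ne_zero :
    ∀ᵐ ω ∂p.law, ∀ B F, ω ∈ openPattern B F → p.law (openPattern B F) ≠ 0 := by
  refine ae_all_iff.2 fun B => ae_all_iff.2 fun F => ?_
  by_cases h : p.law (openPattern B F) = 0
  · filter_upwards [measure_eq_zero_iff_ae_notMem.1 h] with ω hω hω'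
    exact absurd hω' hω
  · exact Filter.Eventually.of_forall fun _ _ => h

theorem integrable_lapCount_eq (Q : Finset G) (lam : ℝ) :
    Integrable (fun ω => (lapCount (percGraph ω) Q (· = lam) : ℝ)) p.law := by
  have h : (fun ω : Config G => (lapCount (percGraph ω) Q (· = lam) : ℝ)) = fun ω =>
      (lapCount (percGraph ω) Q (· ≤ lam) : ℝ) - lapCount (percGraph ω) Q (· < lam) := by
    funext ω
    rw [lapCount_lt_add_eq]
    ring
  rw [h]
  exact ((isLocalLipschitz_lapCount_le Q lam).integrable p).sub
    ((isLocalLipschitz_lapCount_lt Q lam).integrable p)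

/-- Linearity of expectation: by stationarity each tile carries a copy with probability at least
that of `C`, and no independence of tiles is needed. -/
theorem card_mul_law_le_meanCount {B D Q I : Finset G} {s : G} (hB : B ⊆ rightTranslate D s)
    (hsub : ∀ t ∈ I, rightTranslate D t ⊆ Q)
    (hdisj : ∀ r ∈ I, ∀ t ∈ I, r ≠ t → Disjoint (rightTranslate D r) (rightTranslate D t))
    {u : G → ℂ} (hu : ∀ x, u x ≠ 0 → x ∈ B) (hu0 : u ≠ 0) {lam : ℝ} {C : Set (Config G)}
    (hCm : MeasurableSet C)
    (hC : ∀ ω' ∈ C, formalLaplacian (percGraph ω') u = (lam : ℂ) • u) :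
    I.card * p.law.real C ≤ meanCount p Q (· = lam) := by
  have hpre : ∀ t, MeasurableSet (translateConfig (s⁻¹ * t) ⁻¹' C) := fun t =>
    (p.measurePreserving_translateConfig (s⁻¹ * t)).measurable hCm
  have hint : ∀ t, Integrable ((translateConfig (s⁻¹ * t) ⁻¹' C).indicator (1 : Config G → ℝ))
      p.law := fun t => (integrable_const (1 : ℝ)).indicator (hpre t)
  have h1 : ∫ ω, ∑ t ∈ I, (translateConfig (s⁻¹ * t) ⁻¹' C).indicator 1 ω ∂p.law =
      I.card * p.law.real C := by
    rw [integral_finsetSum _ fun t _ => hint t]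
    simp only [integral_indicator_one (hpre _)]
    have : ∀ t ∈ I, p.law.real (translateConfig (s⁻¹ * t) ⁻¹' C) = p.law.real C := fun t _ =>
      (p.measurePreserving_translateConfig (s⁻¹ * t)).measureReal_preimage hCm.nullMeasurableSet
    rw [Finset.sum_congr rfl this, Finset.sum_const, nsmul_eq_mul]
  rw [← h1]
  refine integral_mono_ae
    (integrable_finsetSum _ fun t _ => hint t)
    (integrable_lapCount_eq p Q lam) ?_
  filter_upwards [p.ae_isLocallyFinite] with ω hω
  have h2 := card_translates_le_lapCount_eq hω hB hsub hdisj hu hu0 hC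
  refine le_trans (le_of_eq ?_) (Nat.cast_le.2 h2)
  rw [Finset.card_filter, Nat.cast_sum]
  refine Finset.sum_congr rfl fun t _ => ?_
  by_cases ht : translateConfig (s⁻¹ * t) ω ∈ C
  · rw [if_pos ht, Set.indicator_of_mem (s := translateConfig (s⁻¹ * t) ⁻¹' C) ht, Pi.one_apply,
      Nat.cast_one]
  · rw [if_neg ht, Set.indicator_of_notMem (s := translateConfig (s⁻¹ * t) ⁻¹' C) ht, Nat.cast_zero]

variable {p}

/-- A finitely supported eigenfunction that occurs with positive probability makes the limit
discontinuous. -/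
theorem not_continuousAt_of_openPattern {Q : ℕ → Finset G} (hF : IsFolnerSeq Q)
    (hT : ∀ j, IsMonotile (Q j)) (hQ0 : ∀ j, 0 < (Q j).card) {N : ℝ → ℝ}
    (hN : ∀ᵐ ω ∂p.law, TendstoUniformly
      (fun j E => (lapCount (percGraph ω) (Q j) (· ≤ E) : ℝ) / (Q j).card) N atTop)
    {B : Finset G} {u : G → ℂ} (hu : ∀ x, u x ≠ 0 → x ∈ B) (hu0 : u ≠ 0) {lam : ℝ}
    {C : Set (Config G)} (hCm : MeasurableSet C) (hC0 : p.law C ≠ 0)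
    (hC : ∀ ω' ∈ C, formalLaplacian (percGraph ω') u = (lam : ℂ) • u) :
    ¬ ContinuousAt N lam := by
  intro hcont
  have hQ' : ∀ j, (0 : ℝ) < (Q j).card := fun j => by exact_mod_cast hQ0 j
  have hmean : Tendsto (fun j => meanCount p (Q j) (· = lam) / (Q j).card) atTop (𝓝 0) := by
    have h1 : Tendsto (fun j => ∫ ω, (lapCount (percGraph ω) (Q j) (· = lam) : ℝ) / (Q j).card
        ∂p.law) atTop (𝓝 (∫ _, (0 : ℝ) ∂p.law)) := by
      refine tendsto_integral_of_dominated_convergence (fun _ => 1)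
        (fun j => ((integrable_lapCount_eq p (Q j) lam).div_const _).aestronglyMeasurable)
        (integrable_const _) (fun j => Filter.Eventually.of_forall fun ω => ?_) ?_
      · rw [Real.norm_eq_abs, abs_of_nonneg (by positivity), div_le_one (hQ' j)]
        exact_mod_cast lapCount_le_card _ _ _
      · filter_upwards [hN] with ω hω
        exact (continuousAt_iff_tendsto_lapCount_eq hω lam).1 hcont
    rw [integral_zero] at h1
    simp only [integral_div] at h1
    exact h1
  -- The support must fit into a tile; by the Følner property some `Q_k` contains a right translate
  -- of `B`.
  have hk : ∃ k, ∑ b ∈ B, escapeCount (Q k) b < (Q k).card := by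
    have h1 : Tendsto (fun j => ∑ b ∈ B, (escapeCount (Q j) b : ℝ) / (Q j).card) atTop (𝓝 0) := by
      simpa using tendsto_finsetSum B fun b _ => hF.tendsto_escapeCount_div b
    obtain ⟨k, hk⟩ := (h1.eventually_lt_const (u := 1) one_pos).exists
    refine ⟨k, ?_⟩
    rw [← Finset.sum_div, div_lt_one (hQ' k)] at hk
    exact_mod_cast hk
  obtain ⟨k, hk⟩ := hk
  obtain ⟨s, hs⟩ := exists_subset_rightTranslate hk
  set c := p.law.real C with hc
  have hc0 : 0 < c := ENNReal.toReal_pos hC0 (measure_ne_top _ _)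
  -- At least `(|Q_j| - defect) / |Q_k|` tiles fit into `Q_j`, each contributing `c` in the mean.
  have hlow : ∀ j, c / (Q k).card * (1 - tileDefect (Q k) (Q j) / (Q j).card) ≤
      meanCount p (Q j) (· = lam) / (Q j).card := by
    intro j
    obtain ⟨I, h1, h2, h3⟩ := (hT k).exists_tiles (Q j)
    have h4 := card_mul_law_le_meanCount p hs h1 h2 hu hu0 hCm hC
    have h3' : ((Q j).card : ℝ) ≤ I.card * (Q k).card + tileDefect (Q k) (Q j) := by
      exact_mod_cast h3
    have hk' := hQ' k
    have hj' := hQ' j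
    rw [le_div_iff₀ hj']
    have e1 : c / (Q k).card * (1 - tileDefect (Q k) (Q j) / (Q j).card) * (Q j).card =
        c * ((Q j).card - tileDefect (Q k) (Q j)) / (Q k).card := by
      field_simp
    rw [e1, div_le_iff₀ hk']
    nlinarith
  have hlim : Tendsto (fun j => c / (Q k).card * (1 - (tileDefect (Q k) (Q j) : ℝ) / (Q j).card))
      atTop (𝓝 (c / (Q k).card * (1 - 0))) :=
    ((hF.tendsto_tileDefect_div (Q k)).const_sub 1).const_mul _
  have h5 := le_of_tendsto_of_tendsto' hlim hmean hlow
  have h6 : 0 < c / (Q k).card := div_pos hc0 (hQ' k)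
  linarith

end Discontinuities

end

/-! ### The main theorem -/

theorem theorem5 {G : Type*} [Group G] [Group.FG G] (p : EdgeProfile G)
    (Q : ℕ → Finset G) (hFolner : IsFolnerSeq Q) (hTempered : IsTempered Q)
    (hIncr : ∀ n, (Q n).card < (Q (n + 1)).card) (hTile : ∀ n, IsMonotile (Q n)) :
    ∃ N : ℝ → ℝ, IsIDS p Q N ∧
      ∀ᵐ ω ∂p.law, ∃ h : IsLocallyFinite (percGraph ω), ∀ μ : ℝ,
        List.TFAE [
          ¬ ContinuousAt N μ,
          ∃ u : Ell2 G, IsEigenfunction (laplacian (percGraph ω) h) μ u ∧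
            (Function.support (u : G → ℂ)).Finite,
          ∃ u : ℕ → Ell2 G, LinearIndependent ℂ u ∧
            ∀ n, IsEigenfunction (laplacian (percGraph ω) h) μ (u n) ∧
              (Function.support (u n : G → ℂ)).Finite] := by
  have : Countable G := countable_of_group_fg G
  have hQ0 : 0 < (Q 0).card := by
    obtain ⟨T, hT, -⟩ := hTile 0
    rw [Finset.card_pos]
    by_contra hne
    rw [Finset.not_nonempty_iff_eq_empty] at hne
    have h1 : (1 : G) ∈ ⋃ t ∈ T, ((Q 0 : Finset G) : Set G) * {t} := hT ▸ Set.mem_univ 1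
    simp [hne] at h1
  -- Strict growth from a nonempty start gives the lower bound on `|Q_j|` that makes the deviation
  -- probabilities summable.
  have hQ : ∀ j, j < (Q j).card := by
    intro j
    induction j with
    | zero => exact hQ0
    | succ j ih => exact Nat.lt_of_le_of_lt ih (hIncr j)
  have hQpos : ∀ j, 0 < (Q j).card := fun j => (Nat.zero_le j).trans_lt (hQ j)
  have hQlim : Tendsto (fun j => ((Q j).card : ℝ)) atTop atTop :=
    tendsto_natCast_atTop_atTop.comp (tendsto_atTop_mono (fun j => (hQ j).le) tendsto_id)
  obtain ⟨N, hN⟩ := exists_tendstoUniformly_meanCount p hFolner hTile hQpos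
  have hae := ae_tendstoUniformly_lapCount hQ hN
  refine ⟨N, ?_, ?_⟩
  · unfold IsIDS
    filter_upwards [hae] with ω hω
    simp only [eigenvalueCount_eq_spectralCount]
    exact hω
  · filter_upwards [hae, p.ae_isLocallyFinite, ae_law_openPattern_ne_zero p,
      IsLocalLipschitz.ae_tendsto_sub_integral_div p
        (fun j => isLocalLipschitz_innerBoundary (Q j)) hQ] with ω hω hfin hpat hbd
    refine ⟨hfin, fun μ => ?_⟩
    -- The boundary concentrates about its mean, and the mean is negligible.
    have hbd' : Tendsto (fun j => ((innerBoundary (percGraph ω) (Q j)).card : ℝ) / (Q j).card)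
        atTop (𝓝 0) := by
      have h1 := hbd.add (p.tendsto_integral_innerBoundary_div hFolner)
      rw [add_zero] at h1
      refine h1.congr fun j => ?_
      rw [← add_div, sub_add_cancel]
    tfae_have 1 → 3 := fun h => exists_linearIndependent_eigenfunctions hfin hQlim hbd'
      fun h' => h ((continuousAt_iff_tendsto_lapCount_eq hω μ).2 h')
    tfae_have 3 → 2 := fun ⟨u, _, hu⟩ => ⟨u 0, hu 0⟩
    tfae_have 2 → 1 := by
      rintro ⟨u, hu, husupp⟩
      obtain ⟨hu0, hueig⟩ := (isEigenfunction_laplacian_iff hfin μ u husupp).1 hu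
      obtain ⟨F, hF⟩ := exists_mem_openPattern hfin husupp.toFinset
      have hsupp : ∀ x, (u : G → ℂ) x ≠ 0 → x ∈ husupp.toFinset := fun x hx => by simpa using hx
      refine not_continuousAt_of_openPattern hFolner hTile hQpos hae hsupp
        (fun h => hu0 (lp.ext h)) (measurableSet_openPattern _ F) (hpat _ F hF) fun ω' hω' => ?_
      rw [formalLaplacian_eq_of_openPattern hF hω' hsupp, hueig]
    tfae_finish
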